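/- **Setting.** Let $\varphi=(\varphi(x))_{x\in\mathbb R^2}$ be a jointly measurable, $[0,\infty)$-valued random field on a probability space $(\Theta,\overline{\mathbb P})$ that is stationary, i.e. its law (on the functions $\mathbb R^2\to[0,\infty)$ with the sigma algebra generated by the evaluation maps) is invariant under translations. For $\lambda\ge 0$ let $\mathbb P_\lambda$ be the law of a homogeneous Poisson point process $\eta$ on $\mathbb R^2\times[0,1]$ with intensity $\lambda$, put $\mathbf P_\lambda=\mathbb P_\lambda\times\overline{\mathbb P}$, and let $$\mathcal O=\bigcup_{(x,z)\in\eta}B(x,\varphi(x)),$$ where $B(x,r)$ is the closed Euclidean disc of radius $r$ centred at $x$. For $s,t>0$ let $\mathrm{Cross}(s,t)$ be the event that $\mathcal O\cap([0,s]\times[0,t])$ contains a continuous curve from $\{0\}\times[0,t]$ to $\{s\}\times[0,t]$. Fix $\varepsilon_0\in(0,1/5]$, let $B_\infty(x,r)$ be the closed $\ell_\infty$-ball of radius $r$ centred at $x$, and for $n\ge1$ let $$\rho_\lambda(n)=\sup_{f_1,f_2}\big|\mathbf E_\lambda[f_1(\mathcal O)f_2(\mathcal O)]-\mathbf E_\lambda[f_1(\mathcal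 O)]\,\mathbf E_\lambda[f_2(\mathcal O)]\big|,$$ where the supremum is over all $[0,1]$-valued functions $f_1,f_2$ of subsets of the plane such that $f_1$ is measurable with respect to the sigma algebra generated by the indicators $\mathbf 1\{x\in\mathcal O\}$, $x\in B_\infty(0,n)$, and $f_2$ with respect to the one generated by $\mathbf 1\{x\in\mathcal O\}$, $x\in B_\infty(((2+\varepsilon_0)n,0),n)$. **Proposition 4.1.** Suppose that the law of $\varphi$ is also invariant under rotations by right angles. Let $I\subseteq[0,\infty)$ be an interval and assume that $\rho_\lambda(n)\to0$ as $n\to\infty$ along the integers, uniformly over $\lambda\in I$. Then there exists an integer $N\ge1$ such that for every $\lambda\in I$ the following hold, where $n$ ranges over the real numbers. a) If there exists $n\ge N$ such that $\mathbf P_\lambda(\mathrm{Cross}(3n,n))>1-1/200$, then $\lim_{n\to\infty}\mathbf P_\lambda(\mathrm{Cross}(3n,n))=1$. b) If there exists $n\ge N$ such that $\mathbf P_\lambda(\mathrm{Cross}(n,3n))<1/200$, then $\lim_{n\to\infty}\mathbf P_\lambda(\mathrm{Cross}(n,3n))=0$. -/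

import Mathlib

open MeasureTheory ProbabilityTheory Filter Topology
open scoped NNReal ENNReal

noncomputable section

namespace GilbertDisc

/-- The Euclidean plane. -/
abbrev Plane : Type := EuclideanSpace ℝ (Fin 2)

/-- The space `ℝ² × [0,1]` in which the Poisson points live. -/
abbrev MarkedPlane : Type := Plane × unitInterval

/-- Locally finite point configurations in `ℝ² × [0,1]`, i.e. supports of counting measures. -/
def PointConfig : Type := {s : Set MarkedPlane // ∀ K, IsCompact K → (s ∩ K).Finite}

/-- The smallest sigma algebra for which all events "there are exactly `k` points in the Borel
set `B`" are measurable. -/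
instance : MeasurableSpace PointConfig :=
  MeasurableSpace.generateFrom
    {A | ∃ (B : Set MarkedPlane) (k : ℕ), MeasurableSet B ∧
      A = {s : PointConfig | (s.1 ∩ B).encard = k}}

/-- `P` is the law of a homogeneous Poisson point process on `ℝ² × [0,1]` with intensity `l`:
the numbers of points in finitely many pairwise disjoint Borel sets of finite volume are
independent Poisson variables with means `l` times the volumes. -/
def IsPoissonLaw (l : ℝ≥0) (P : Measure PointConfig) : Prop :=
  ∀ (m : ℕ) (B : Fin m → Set MarkedPlane),
    (∀ i, MeasurableSet (B i)) → (∀ i, volume (B i) < ∞) →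
    Pairwise (fun i j => Disjoint (B i) (B j)) →
    ∀ k : Fin m → ℕ,
      P {s : PointConfig | ∀ i, (s.1 ∩ B i).encard = k i} =
        ∏ i, poissonMeasure (l * (volume (B i)).toNNReal) {k i}

/-- Rotation of the plane by a right angle, `(x, y) ↦ (-y, x)`. -/
def rot (x : Plane) : Plane := !₂[-(x 1), x 0]

section Field

variable {Θ : Type*} [MeasurableSpace Θ]

/-- The law of the random field `φ`, as a measure on the functions `ℝ² → [0,∞)` with the sigma
algebra generated by the evaluation maps, is invariant under all translations. -/
def IsStationaryField (Q : Measure Θ) (φ : Θ → Plane → ℝ≥0) : Prop :=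
  ∀ v : Plane, Q.map (fun θ (x : Plane) => φ θ (x + v)) = Q.map φ

/-- The law of the random field `φ` is invariant under rotations by right angles. -/
def IsRotationInvariantField (Q : Measure Θ) (φ : Θ → Plane → ℝ≥0) : Prop :=
  Q.map (fun θ (x : Plane) => φ θ (rot x)) = Q.map φ

end Field

/-- The occupied set: the union of the closed discs centred at the (projected) points of the
configuration, the disc at `x` having radius `r x`. -/
def occupied (s : PointConfig) (r : Plane → ℝ≥0) : Set Plane :=
  ⋃ p ∈ s.1, Metric.closedBall p.1 (r p.1 : ℝ)

/-- The rectangle `[0,a] × [0,b]`. -/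
def rectangle (a b : ℝ) : Set Plane :=
  {x | x 0 ∈ Set.Icc 0 a ∧ x 1 ∈ Set.Icc 0 b}

/-- The set `O`, restricted to `[0,a] × [0,b]`, contains a continuous curve from the left side
`{0} × [0,b]` to the right side `{a} × [0,b]`. -/
def HasCrossing (O : Set Plane) (a b : ℝ) : Prop :=
  ∃ x y : Plane, x 0 = 0 ∧ y 0 = a ∧ JoinedIn (O ∩ rectangle a b) x y

/-- The closed `ℓ∞`-ball (square) with centre `x` and radius `r`. -/
def square (x : Plane) (r : ℝ) : Set Plane := {y | ∀ i, |y i - x i| ≤ r}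

/-- The sigma algebra on subsets of the plane generated by the indicators of `x ∈ O`, `x ∈ K`. -/
abbrev windowSigma (K : Set Plane) : MeasurableSpace (Set Plane) :=
  ⨆ x ∈ K, MeasurableSpace.comap (fun O : Set Plane => x ∈ O) ⊤

section Model

variable {Θ : Type*} [MeasurableSpace Θ]

/-- The probability of a horizontal occupied crossing of `[0,a] × [0,b]`, when the Poisson points
have law `P` and, independently, the radii are given by the field `φ` on `(Θ, Q)`. -/
def crossProb (P : Measure PointConfig) (Q : Measure Θ) (φ : Θ → Plane → ℝ≥0) (a b : ℝ) : ℝ :=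
  (P.prod Q).real {ω | HasCrossing (occupied ω.1 (φ ω.2)) a b}

/-- The covariance of two functions of the occupied set. -/
def occCov (P : Measure PointConfig) (Q : Measure Θ) (φ : Θ → Plane → ℝ≥0)
    (f g : Set Plane → ℝ) : ℝ :=
  (∫ ω, f (occupied ω.1 (φ ω.2)) * g (occupied ω.1 (φ ω.2)) ∂(P.prod Q)) -
    (∫ ω, f (occupied ω.1 (φ ω.2)) ∂(P.prod Q)) * (∫ ω, g (occupied ω.1 (φ ω.2)) ∂(P.prod Q))

/-- The correlation coefficient: the supremum of `|Cov (f, g)|` over `[0,1]`-valued functions `f`,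
`g` of the occupied set that depend only on its restriction to the square of radius `r` around the
origin and around `((2 + ε) r, 0)`, respectively. -/
def rho (ε : ℝ) (P : Measure PointConfig) (Q : Measure Θ) (φ : Θ → Plane → ℝ≥0) (r : ℝ) : ℝ :=
  sSup {c : ℝ | ∃ f g : Set Plane → ℝ,
    (∀ O, f O ∈ Set.Icc (0 : ℝ) 1) ∧ (∀ O, g O ∈ Set.Icc (0 : ℝ) 1) ∧
    Measurable[windowSigma (square 0 r)] f ∧
    Measurable[windowSigma (square !₂[(2 + ε) * r, 0] r)] g ∧
    c = |occCov P Q φ f g|}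

end Model

end GilbertDisc

end

/-! Let x(n) be the probability that the 3n × n rectangle is not crossed the long way (part a), or
that the n × 3n rectangle is crossed the short way (part b). Seven rectangles and a union bound show
that the same bad event for a 9n × n rectangle has probability at most 7 x(n). The bad event for a
9n × 3n rectangle forces the bad event in two separated 9n × n strips inside it. As ρ bounds the
dependence between the strips, x(3n) ≤ 49 x(n)² + ρ(r) with r about 9n/2 (`IsModel.renormalize_not`,
`IsModel.renormalize`). Below 1/200 the quadratic term is at most x/4, so x tends to zero along 3^k
n₀, and x(m) ≤ 7 x(n) for n ≤ m ≤ 3n fills the gaps (`tendsto_zero_of_tripling`).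

Gluing crossings in part a requires that a horizontal and a vertical crossing of a rectangle meet.
This is `exists_path_eq_path`, a consequence of the Poincaré–Miranda theorem, which is proved by
lifting through the exponential.

The measure-theoretic difficulty is that ρ only tests events generated by the indicators of single
points, while a crossing involves uncountably many points. Stationarity gives a dichotomy
(`ae_occupied`): almost surely the occupied set is the whole plane, or only finitely many discs come
near any bounded set. In the second case a crossing fails exactly when finitely many balls separate
the two sides, and this can be read off from a dense sequence (`sepEvent`). Crossing events thus
agree almost surely with admissible ones. Their invariance under translations and right-angle
rotations follows from that of the field and from uniqueness of the Poisson law. -/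

namespace GilbertDisc

/-! ### Planar topology: Poincaré–Miranda and intersecting paths. -/

section PlanarTopology

/-- A continuous real function on `[0,1]` whose sine stays nonnegative stays in one of the
intervals `[2πk, 2πk + π]`. -/
lemma exists_int_of_sin_nonneg {θ : ℝ → ℝ} (hθ : Continuous θ)
    (h : ∀ t ∈ Set.Icc (0 : ℝ) 1, 0 ≤ Real.sin (θ t)) :
    ∃ k : ℤ, ∀ t ∈ Set.Icc (0 : ℝ) 1,
      2 * Real.pi * k ≤ θ t ∧ θ t ≤ 2 * Real.pi * k + Real.pi := by
  have hpi := Real.pi_pos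
  have hneg : ∀ (k : ℤ) (x : ℝ), 2 * Real.pi * k - Real.pi < x → x < 2 * Real.pi * k →
      Real.sin x < 0 := by
    intro k x h1 h2
    have : Real.sin x = Real.sin (x - k * (2 * Real.pi)) := (Real.sin_sub_int_mul_two_pi x k).symm
    rw [this]
    exact Real.sin_neg_of_neg_of_neg_pi_lt (by linarith) (by linarith)
  have hival : ∀ (u v c : ℝ), u ∈ Set.Icc (0 : ℝ) 1 → v ∈ Set.Icc (0 : ℝ) 1 → θ u ≤ c → c ≤ θ v →
      ∃ w ∈ Set.Icc (0 : ℝ) 1, θ w = c := by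
    intro u v c hu hv h1 h2
    exact isPreconnected_Icc.intermediate_value₂ hu hv hθ.continuousOn continuousOn_const h1 h2
  refine ⟨⌊θ 0 / (2 * Real.pi)⌋, fun t ht => ?_⟩
  set k := ⌊θ 0 / (2 * Real.pi)⌋ with hk
  have h0 : (0 : ℝ) ∈ Set.Icc (0 : ℝ) 1 := ⟨le_rfl, zero_le_one⟩
  have hk1 : 2 * Real.pi * k ≤ θ 0 := by
    have := Int.floor_le (θ 0 / (2 * Real.pi))
    rw [le_div_iff₀ (by positivity)] at this
    linarith
  have hk2 : θ 0 < 2 * Real.pi * k + 2 * Real.pi := by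
    have := Int.lt_floor_add_one (θ 0 / (2 * Real.pi))
    rw [div_lt_iff₀ (by positivity)] at this
    linarith
  have hk3 : θ 0 ≤ 2 * Real.pi * k + Real.pi := by
    by_contra hc
    push Not at hc
    have := hneg (k + 1) (θ 0) (by push_cast; linarith) (by push_cast; linarith)
    linarith [h 0 h0]
  constructor
  · by_contra hc
    push Not at hc
    -- `θ t` may lie far below the interval; the maximum picks an intermediate value in the gap just
    -- below it, where the sine is negative.
    obtain ⟨w, hw, hw'⟩ := hival t 0 (max (θ t) (2 * Real.pi * k - Real.pi / 2)) ht h0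
      (le_max_left _ _) (max_le (by linarith) (by linarith))
    have := hneg k (θ w)
      (by rw [hw']; exact lt_of_lt_of_le (by linarith) (le_max_right _ _))
      (by rw [hw']; exact max_lt hc (by linarith))
    linarith [h w hw]
  · by_contra hc
    push Not at hc
    obtain ⟨w, hw, hw'⟩ := hival 0 t (min (θ t) (2 * Real.pi * k + 3 * Real.pi / 2)) h0 ht
      (le_min (by linarith) (by linarith)) (min_le_left _ _)
    have := hneg (k + 1) (θ w)
      (by rw [hw']; push_cast; exact lt_min (by linarith) (by linarith))
      (by rw [hw']; push_cast; exact lt_of_le_of_lt (min_le_right _ _) (by linarith))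
    linarith [h w hw]

/-- The two-dimensional Poincaré–Miranda theorem. -/
lemma exists_zero_of_boundary_signs {F : ℝ × ℝ → ℂ} (hF : Continuous F)
    (hleft : ∀ t ∈ Set.Icc (0 : ℝ) 1, (F (0, t)).re ≤ 0)
    (hright : ∀ t ∈ Set.Icc (0 : ℝ) 1, 0 ≤ (F (1, t)).re)
    (hbot : ∀ t ∈ Set.Icc (0 : ℝ) 1, 0 ≤ (F (t, 0)).im)
    (htop : ∀ t ∈ Set.Icc (0 : ℝ) 1, (F (t, 1)).im ≤ 0) : ∃ p, F p = 0 := by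
  by_contra! hne
  -- Having no zero on the simply connected plane, `F` has a continuous logarithm `f`, and `(f
  -- p).im` is a continuous argument of `F p`. Each side of the square confines it to one half-turn.
  obtain ⟨f, ⟨-, hf⟩, -⟩ := Complex.isCoveringMapOn_exp.existsUnique_continuousMap_lifts
    ⟨F, hF⟩ (Complex.exp_log (hne (0, 0))) (fun p => hne p)
  have hexp : ∀ p, F p = Complex.exp (f p) := fun p => (congrFun hf p).symm
  have hre : ∀ p, (F p).re = Real.exp (f p).re * Real.cos (f p).im := fun p => by
    rw [hexp, Complex.exp_re]
  have him : ∀ p, (F p).im = Real.exp (f p).re * Real.sin (f p).im := fun p => by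
    rw [hexp, Complex.exp_im]
  have hcont : Continuous fun p => (f p).im := Complex.continuous_im.comp f.continuous
  have hb1 : ∀ t ∈ Set.Icc (0 : ℝ) 1, 0 ≤ Real.sin (f (t, 0)).im := fun t ht => by
    have := hbot t ht
    rw [him] at this
    exact nonneg_of_mul_nonneg_right this (Real.exp_pos _)
  have hr1 : ∀ t ∈ Set.Icc (0 : ℝ) 1, 0 ≤ Real.sin ((f (1, t)).im + Real.pi / 2) := fun t ht => by
    have := hright t ht
    rw [hre] at this
    rw [Real.sin_add_pi_div_two]
    exact nonneg_of_mul_nonneg_right this (Real.exp_pos _)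
  have ht1 : ∀ t ∈ Set.Icc (0 : ℝ) 1, 0 ≤ Real.sin ((f (t, 1)).im + Real.pi) := fun t ht => by
    have := htop t ht
    rw [him] at this
    rw [Real.sin_add_pi]
    have h2 : 0 ≤ Real.exp (f (t, 1)).re * -Real.sin (f (t, 1)).im := by linarith
    exact nonneg_of_mul_nonneg_right h2 (Real.exp_pos _)
  have hl1 : ∀ t ∈ Set.Icc (0 : ℝ) 1, 0 ≤ Real.sin ((f (0, t)).im - Real.pi / 2) := fun t ht => by
    have := hleft t ht
    rw [hre] at this
    rw [Real.sin_sub_pi_div_two]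
    have h2 : 0 ≤ Real.exp (f (0, t)).re * -Real.cos (f (0, t)).im := by linarith
    exact nonneg_of_mul_nonneg_right h2 (Real.exp_pos _)
  obtain ⟨k, hk⟩ := exists_int_of_sin_nonneg (θ := fun t => (f (t, 0)).im)
    (hcont.comp (by fun_prop)) hb1
  obtain ⟨j, hj⟩ := exists_int_of_sin_nonneg (θ := fun t => (f (1, t)).im + Real.pi / 2)
    ((hcont.comp (by fun_prop : Continuous fun t : ℝ => ((1 : ℝ), t))).add continuous_const) hr1
  obtain ⟨i, hi⟩ := exists_int_of_sin_nonneg (θ := fun t => (f (t, 1)).im + Real.pi)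
    ((hcont.comp (by fun_prop : Continuous fun t : ℝ => (t, (1 : ℝ)))).add continuous_const) ht1
  obtain ⟨h, hh⟩ := exists_int_of_sin_nonneg (θ := fun t => (f (0, t)).im - Real.pi / 2)
    ((hcont.comp (by fun_prop : Continuous fun t : ℝ => ((0 : ℝ), t))).sub continuous_const) hl1
  have hpi := Real.pi_pos
  have h0 : (0 : ℝ) ∈ Set.Icc (0 : ℝ) 1 := ⟨le_rfl, zero_le_one⟩
  have h1 : (1 : ℝ) ∈ Set.Icc (0 : ℝ) 1 := ⟨zero_le_one, le_rfl⟩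
  have key : ∀ a b : ℤ, 2 * Real.pi * a < 2 * Real.pi * b + 2 * Real.pi → a ≤ b := by
    intro a b hab
    have : (a : ℝ) < b + 1 := by
      by_contra hc
      push Not at hc
      nlinarith
    exact Int.lt_add_one_iff.mp (by exact_mod_cast this)
  have a1 := hk 0 h0
  have a2 := hk 1 h1
  have a3 := hj 0 h0
  have a4 := hj 1 h1
  have a5 := hi 0 h0
  have a6 := hi 1 h1
  have a7 := hh 0 h0
  have a8 := hh 1 h1
  -- Comparing half-turns at the four corners: bottom, right and top carry the same integer, while
  -- the left side would have to be level with the bottom and a full turn below the top. The winding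
  -- number would be both 0 and 1.
  have e1 : j ≤ k := key _ _ (by linarith)
  have e2 : k ≤ j := key _ _ (by linarith)
  have e3 : j ≤ i := key _ _ (by linarith)
  have e4 : i ≤ j := key _ _ (by linarith)
  have e5 : k ≤ h := key _ _ (by linarith)
  have e6 : h + 1 ≤ i := key _ _ (by push_cast; linarith)
  omega

/-- Any two points of a path are joined along the path. -/
lemma joinedIn_range_path {X : Type*} [TopologicalSpace X] {x y : X} (γ : Path x y)
    (s t : unitInterval) : JoinedIn (Set.range γ) (γ s) (γ t) := by
  have : PathConnectedSpace unitInterval := isPathConnected_iff_pathConnectedSpace.mp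
    ((convex_Icc (0 : ℝ) 1).isPathConnected ⟨0, le_rfl, zero_le_one⟩)
  exact (isPathConnected_range γ.continuous).joinedIn _ ⟨s, rfl⟩ _ ⟨t, rfl⟩

/-- A path crossing a rectangle horizontally meets each path crossing it vertically. -/
lemma exists_path_eq_path {x y u v : Plane} (γ : Path x y) (δ : Path u v)
    (hδ : ∀ t, x 0 ≤ δ t 0 ∧ δ t 0 ≤ y 0) (hγ : ∀ t, u 1 ≤ γ t 1 ∧ γ t 1 ≤ v 1) :
    ∃ s t, γ s = δ t := by
  have hc : ∀ i : Fin 2, Continuous fun z : Plane => z i := fun i => by fun_prop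
  -- A zero of the difference of the two paths is a meeting point. Extending the paths by constants
  -- makes the difference continuous on the whole plane.
  let F : ℝ × ℝ → ℂ := fun p =>
    ⟨γ.extend p.1 0 - δ.extend p.2 0, γ.extend p.1 1 - δ.extend p.2 1⟩
  have hF : Continuous F := by
    have h1 : ∀ i : Fin 2, Continuous fun p : ℝ × ℝ => γ.extend p.1 i - δ.extend p.2 i := fun i =>
      ((hc i).comp (γ.continuous_extend.comp continuous_fst)).sub
        ((hc i).comp (δ.continuous_extend.comp continuous_snd))
    exact Complex.equivRealProdCLM.symm.continuous.comp ((h1 0).prodMk (h1 1))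
  have hex : ∀ {a b : Plane} (η : Path a b) (t : ℝ), ∃ s, η.extend t = η s := fun η t =>
    ⟨Set.projIcc 0 1 zero_le_one t, rfl⟩
  obtain ⟨p, hp⟩ := exists_zero_of_boundary_signs hF
    (fun t _ => by
      obtain ⟨s, hs⟩ := hex δ t
      simp only [F, Path.extend_zero, hs]
      linarith [(hδ s).1])
    (fun t _ => by
      obtain ⟨s, hs⟩ := hex δ t
      simp only [F, Path.extend_one, hs]
      linarith [(hδ s).2])
    (fun t _ => by
      obtain ⟨s, hs⟩ := hex γ t
      simp only [F, Path.extend_zero, hs]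
      linarith [(hγ s).1])
    (fun t _ => by
      obtain ⟨s, hs⟩ := hex γ t
      simp only [F, Path.extend_one, hs]
      linarith [(hγ s).2])
  obtain ⟨s, hs⟩ := hex γ p.1
  obtain ⟨t, ht⟩ := hex δ p.2
  refine ⟨s, t, ?_⟩
  rw [← hs, ← ht]
  have h0 := congrArg Complex.re hp
  have h1 := congrArg Complex.im hp
  ext i
  fin_cases i
  · exact sub_eq_zero.mp h0
  · exact sub_eq_zero.mp h1

/-- A continuous function that passes from below `a` to above `b` does so within `[a,b]` on some
subinterval. -/
lemma exists_subinterval_crossing {f : ℝ → ℝ} (hf : Continuous f) {a b : ℝ} (hab : a ≤ b)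
    (h0 : f 0 ≤ a) (h1 : b ≤ f 1) :
    ∃ s t, 0 ≤ s ∧ s ≤ t ∧ t ≤ 1 ∧ f s = a ∧ f t = b ∧ ∀ u ∈ Set.Icc s t, a ≤ f u ∧ f u ≤ b := by
  -- `t` is the first time at or above `b`, and `s` the last time before `t` at or below `a`.
  obtain ⟨t, ⟨ht, htb⟩, htmin⟩ : ∃ t, IsLeast (Set.Icc (0 : ℝ) 1 ∩ f ⁻¹' Set.Ici b) t :=
    (isCompact_Icc.inter_right (isClosed_Ici.preimage hf)).exists_isLeast
      ⟨1, ⟨zero_le_one, le_rfl⟩, h1⟩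
  obtain ⟨s, ⟨hs, hsa⟩, hsmax⟩ : ∃ s, IsGreatest (Set.Icc (0 : ℝ) t ∩ f ⁻¹' Set.Iic a) s :=
    (isCompact_Icc.inter_right (isClosed_Iic.preimage hf)).exists_isGreatest
      ⟨0, ⟨le_rfl, ht.1⟩, h0⟩
  simp only [Set.mem_preimage, Set.mem_Ici, Set.mem_Iic] at htb hsa
  have hlt : ∀ u ∈ Set.Icc (0 : ℝ) t, b < f u → False := by
    intro u hu hbu
    obtain ⟨w, hw, hwb⟩ := intermediate_value_Icc hu.1 hf.continuousOn
      (⟨h0.trans hab, hbu.le⟩ : b ∈ Set.Icc (f 0) (f u))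
    have h2 := htmin ⟨⟨hw.1, hw.2.trans (hu.2.trans ht.2)⟩, hwb.ge⟩
    have : w = u := le_antisymm hw.2 (hu.2.trans h2)
    subst this
    exact hbu.ne' hwb
  have hgt : ∀ u ∈ Set.Icc s t, f u < a → False := by
    intro u hu hua
    obtain ⟨w, hw, hwa⟩ := intermediate_value_Icc hu.2 hf.continuousOn
      (⟨hua.le, hab.trans htb⟩ : a ∈ Set.Icc (f u) (f t))
    have h2 := hsmax ⟨⟨(hs.1.trans hu.1).trans hw.1, hw.2⟩, hwa.le⟩
    have : w = u := le_antisymm (h2.trans hu.1) hw.1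
    subst this
    exact hua.ne hwa
  have hmem : ∀ u ∈ Set.Icc s t, a ≤ f u ∧ f u ≤ b := fun u hu =>
    ⟨not_lt.mp fun h => hgt u hu h, not_lt.mp fun h => hlt u ⟨hs.1.trans hu.1, hu.2⟩ h⟩
  exact ⟨s, t, hs.1, hs.2, ht.2, le_antisymm hsa (hmem s ⟨le_rfl, hs.2⟩).1,
    le_antisymm (hmem t ⟨hs.2, le_rfl⟩).2 htb, hmem⟩

/-- A connection across a slab contains a connection between its faces inside the slab. -/
lemma JoinedIn.exists_slab {S : Set Plane} {x y : Plane} (h : JoinedIn S x y) (i : Fin 2) {a b : ℝ}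
    (hab : a ≤ b) (hx : x i ≤ a) (hy : b ≤ y i) :
    ∃ x' y' : Plane, x' i = a ∧ y' i = b ∧ JoinedIn S x x' ∧ JoinedIn S y' y ∧
      JoinedIn (S ∩ {z | z i ∈ Set.Icc a b}) x' y' := by
  obtain ⟨γ, hγ⟩ := h
  have hext : ∀ t, γ.extend t ∈ S := fun t => hγ _
  obtain ⟨s, t, hs, hst, ht, hsa, htb, hmem⟩ := exists_subinterval_crossing
    (f := fun t => γ.extend t i) (by have := γ.continuous_extend; fun_prop) hab
    (by simpa using hx) (by simpa using hy)
  have hcomb : ∀ u v : ℝ, ∀ T : Set Plane, u ≤ v → (∀ w ∈ Set.Icc u v, γ.extend w ∈ T) →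
      JoinedIn T (γ.extend u) (γ.extend v) := by
    intro u v T huv hT
    refine JoinedIn.ofLine (f := fun r => γ.extend (u + (v - u) * r)) ?_ (by simp) (by simp) ?_
    · exact (γ.continuous_extend.comp (by fun_prop)).continuousOn
    · rintro _ ⟨r, hr, rfl⟩
      have h1 := mul_nonneg (sub_nonneg.mpr huv) hr.1
      have h2 := mul_le_mul_of_nonneg_left hr.2 (sub_nonneg.mpr huv)
      exact hT _ ⟨by linarith, by linarith⟩
  refine ⟨γ.extend s, γ.extend t, hsa, htb, ?_, ?_, ?_⟩
  · simpa using hcomb 0 s S hs fun w _ => hext w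
  · simpa using hcomb t 1 S ht fun w _ => hext w
  · exact hcomb s t _ hst fun w hw => ⟨hext w, hmem w hw⟩

end PlanarTopology

/-! ### Monotonicity, gluing and splitting of rectangle crossings. -/

section Crossings

/-- The rectangle `[a,b] × [c,d]`. -/
def box (a b c d : ℝ) : Set Plane := {x | x 0 ∈ Set.Icc a b ∧ x 1 ∈ Set.Icc c d}

/-- Horizontal crossing of `[a,b] × [c,d]`. -/
def HCross (O : Set Plane) (a b c d : ℝ) : Prop :=
  ∃ x y : Plane, x 0 = a ∧ y 0 = b ∧ JoinedIn (O ∩ box a b c d) x y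

/-- Vertical crossing of `[a,b] × [c,d]`. -/
def VCross (O : Set Plane) (a b c d : ℝ) : Prop :=
  ∃ x y : Plane, x 1 = c ∧ y 1 = d ∧ JoinedIn (O ∩ box a b c d) x y

/-- Shortening the rectangle cuts the curve down to the slab between the new sides; heightening it
only relaxes the constraint. -/
lemma HCross.mono {O : Set Plane} {a b c d a' b' c' d' : ℝ} (h : HCross O a b c d)
    (ha : a ≤ a') (hab : a' ≤ b') (hb : b' ≤ b) (hc : c' ≤ c) (hd : d ≤ d') :
    HCross O a' b' c' d' := by
  obtain ⟨x, y, hx, hy, hxy⟩ := h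
  obtain ⟨x', y', hx', hy', -, -, hj⟩ := JoinedIn.exists_slab hxy 0 hab (by linarith) (by linarith)
  refine ⟨x', y', hx', hy', hj.mono ?_⟩
  rintro z ⟨⟨hz, -, hz1⟩, hz0⟩
  exact ⟨hz, hz0, hc.trans hz1.1, hz1.2.trans hd⟩

lemma VCross.mono {O : Set Plane} {a b c d a' b' c' d' : ℝ} (h : VCross O a b c d)
    (ha : a' ≤ a) (hb : b ≤ b') (hc : c ≤ c') (hcd : c' ≤ d') (hd : d' ≤ d) :
    VCross O a' b' c' d' := by
  obtain ⟨x, y, hx, hy, hxy⟩ := h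
  obtain ⟨x', y', hx', hy', -, -, hj⟩ := JoinedIn.exists_slab hxy 1 hcd (by linarith) (by linarith)
  refine ⟨x', y', hx', hy', hj.mono ?_⟩
  rintro z ⟨⟨hz, hz0, -⟩, hz1⟩
  exact ⟨hz, ⟨ha.trans hz0.1, hz0.2.trans hb⟩, hz1⟩

/-- The meeting point lemma in terms of connections. -/
lemma JoinedIn.joinedIn_of_cross {O : Set Plane} {a b c d : ℝ} {x y u v : Plane}
    (h : JoinedIn (O ∩ box a b c d) x y) (k : JoinedIn (O ∩ box a b c d) u v)
    (hx : x 0 = a) (hy : y 0 = b) (hu : u 1 = c) (hv : v 1 = d) :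
    JoinedIn (O ∩ box a b c d) x u := by
  obtain ⟨γ, hγ⟩ := h
  obtain ⟨δ, hδ⟩ := k
  obtain ⟨s, t, hst⟩ := exists_path_eq_path γ δ
    (fun t => by rw [hx, hy]; exact (hδ t).2.1) (fun t => by rw [hu, hv]; exact (hγ t).2.2)
  have h1 : JoinedIn (Set.range γ) x (γ s) := by simpa using joinedIn_range_path γ 0 s
  have h2 : JoinedIn (Set.range δ) (δ t) u := by simpa using joinedIn_range_path δ t 0
  refine (h1.mono (Set.range_subset_iff.mpr hγ)).trans ?_
  rw [hst]
  exact h2.mono (Set.range_subset_iff.mpr hδ)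

/-- Two overlapping horizontal crossings are glued by a vertical crossing of the overlap. -/
lemma HCross.glue {O : Set Plane} {a b a' b' c d : ℝ} (h : HCross O a b c d)
    (h' : HCross O a' b' c d) (k : VCross O a' b c d) (ha : a ≤ a') (hab : a' ≤ b) (hb : b ≤ b') :
    HCross O a b' c d := by
  obtain ⟨x, y, hx, hy, hxy⟩ := h
  obtain ⟨x', y', hx', hy', hxy'⟩ := h'
  obtain ⟨u, v, hu, hv, huv⟩ := k
  obtain ⟨p, q, hp, hq, hxp, -, hpq⟩ := JoinedIn.exists_slab hxy 0 hab (by linarith) (by linarith)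
  obtain ⟨p', q', hp', hq', -, hqy', hpq'⟩ :=
    JoinedIn.exists_slab hxy' 0 hab (by linarith) (by linarith)
  have hsub : O ∩ box a b c d ⊆ O ∩ box a b' c d := fun z hz =>
    ⟨hz.1, ⟨hz.2.1.1, hz.2.1.2.trans hb⟩, hz.2.2⟩
  have hsub' : O ∩ box a' b' c d ⊆ O ∩ box a b' c d := fun z hz =>
    ⟨hz.1, ⟨ha.trans hz.2.1.1, hz.2.1.2⟩, hz.2.2⟩
  have hsub'' : O ∩ box a' b c d ⊆ O ∩ box a b' c d := fun z hz =>
    ⟨hz.1, ⟨ha.trans hz.2.1.1, hz.2.1.2.trans hb⟩, hz.2.2⟩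
  -- Each horizontal curve has a piece crossing the overlap, and both pieces meet the same vertical
  -- crossing, so everything is joined through `u`.
  have e1 : JoinedIn (O ∩ box a' b c d) p u := JoinedIn.joinedIn_of_cross
    (hpq.mono fun z hz => ⟨hz.1.1, hz.2, hz.1.2.2⟩) huv hp hq hu hv
  have e2' : JoinedIn (O ∩ box a' b c d) p' q' := hpq'.mono fun z hz => ⟨hz.1.1, hz.2, hz.1.2.2⟩
  have e2 : JoinedIn (O ∩ box a' b c d) p' u := JoinedIn.joinedIn_of_cross e2' huv hp' hq' hu hv
  exact ⟨x, y', hx, hy', (hxp.mono hsub).trans (((e1.trans (e2.symm.trans e2')).mono hsub'').trans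
    (hqy'.mono hsub'))⟩

/-- A horizontal crossing stays below a level, or above a smaller one, or crosses the slab in
between vertically. -/
lemma HCross.split {O : Set Plane} {a b c c' d' d : ℝ} (h : HCross O a b c d) (hcd : c' ≤ d') :
    HCross O a b c d' ∨ VCross O a b c' d' ∨ HCross O a b c' d := by
  obtain ⟨x, y, hx, hy, γ, hγ⟩ := h
  by_cases h1 : ∀ t, γ t 1 ≤ d'
  · exact Or.inl ⟨x, y, hx, hy, γ, fun t => ⟨(hγ t).1, (hγ t).2.1, (hγ t).2.2.1, h1 t⟩⟩
  by_cases h2 : ∀ t, c' ≤ γ t 1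
  · exact Or.inr (Or.inr ⟨x, y, hx, hy, γ, fun t => ⟨(hγ t).1, (hγ t).2.1, h2 t, (hγ t).2.2.2⟩⟩)
  push Not at h1 h2
  obtain ⟨t, ht⟩ := h1
  obtain ⟨s, hs⟩ := h2
  have hj : JoinedIn (O ∩ box a b c d) (γ s) (γ t) :=
    (joinedIn_range_path γ s t).mono (Set.range_subset_iff.mpr hγ)
  obtain ⟨p, q, hp, hq, -, -, hpq⟩ := JoinedIn.exists_slab hj 1 hcd hs.le ht.le
  exact Or.inr (Or.inl ⟨p, q, hp, hq, hpq.mono fun z hz => ⟨hz.1.1, hz.1.2.1, hz.2⟩⟩)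

end Crossings

/-! ### Measurability of events about points of the configuration. -/

section Configurations

/-- The points of `ℝ² × [0,1]` whose planar part has norm at most `n`. -/
def cylinder (n : ℕ) : Set MarkedPlane := {p | ‖p.1‖ ≤ n}

lemma isCompact_cylinder (n : ℕ) : IsCompact (cylinder n) := by
  have h : cylinder n = Metric.closedBall (0 : Plane) n ×ˢ (Set.univ : Set unitInterval) := by
    ext p; simp [cylinder]
  rw [h]
  exact (isCompact_closedBall _ _).prod isCompact_univ

lemma measurableSet_cylinder (n : ℕ) : MeasurableSet (cylinder n) :=
  (isCompact_cylinder n).measurableSet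

lemma monotone_cylinder : Monotone cylinder := fun m n hmn p hp =>
  le_trans (show ‖p.1‖ ≤ m from hp) (by exact_mod_cast hmn)

lemma exists_mem_cylinder (p : MarkedPlane) : ∃ n, p ∈ cylinder n := exists_nat_ge ‖p.1‖

lemma PointConfig.finite_inter_cylinder (s : PointConfig) (n : ℕ) : (s.1 ∩ cylinder n).Finite :=
  s.2 _ (isCompact_cylinder n)

lemma PointConfig.eq_iUnion (s : PointConfig) : s.1 = ⋃ n, s.1 ∩ cylinder n := by
  rw [← Set.inter_iUnion, Set.iUnion_eq_univ_iff.mpr exists_mem_cylinder, Set.inter_univ]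

lemma PointConfig.countable (s : PointConfig) : s.1.Countable := by
  rw [s.eq_iUnion]
  exact Set.countable_iUnion fun n => (s.finite_inter_cylinder n).countable

lemma measurableSet_encard_eq {B : Set MarkedPlane} (hB : MeasurableSet B) (k : ℕ) :
    MeasurableSet {s : PointConfig | (s.1 ∩ B).encard = k} :=
  MeasurableSpace.measurableSet_generateFrom ⟨B, k, hB, rfl⟩

lemma measurable_encard_inter {B : Set MarkedPlane} (hB : MeasurableSet B) :
    Measurable fun s : PointConfig => (s.1 ∩ B).encard :=
  ENat.measurable_iff.2 fun k => measurableSet_encard_eq hB k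

/-- The counting measure of the points of `s` in a cylinder. -/
noncomputable def countOn (n : ℕ) (s : PointConfig) : Measure MarkedPlane :=
  Measure.count.restrict (s.1 ∩ cylinder n)

lemma countOn_apply (n : ℕ) (s : PointConfig) {B : Set MarkedPlane} (hB : MeasurableSet B) :
    countOn n s B = ((s.1 ∩ (cylinder n ∩ B)).encard : ℕ∞) := by
  have hs : MeasurableSet (s.1 ∩ cylinder n) := (s.finite_inter_cylinder n).measurableSet
  rw [countOn, Measure.restrict_apply hB, Measure.count_apply (hB.inter hs)]
  congr 2
  ext p
  simp only [Set.mem_inter_iff]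
  tauto

instance (n : ℕ) (s : PointConfig) : IsFiniteMeasure (countOn n s) := by
  refine ⟨?_⟩
  rw [countOn_apply n s MeasurableSet.univ, Set.inter_univ]
  have := (s.finite_inter_cylinder n).encard_lt_top
  exact ENat.toENNReal_lt_top.2 this

lemma measurable_countOn (n : ℕ) {B : Set MarkedPlane} (hB : MeasurableSet B) :
    Measurable fun s => countOn n s B := by
  simp_rw [countOn_apply n _ hB]
  exact Measurable.of_discrete.comp
    (measurable_encard_inter ((measurableSet_cylinder n).inter hB))

/-- Monotone class argument from measurable rectangles. Complements require subtraction, which is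
why the count is restricted to a cylinder, where it is finite. -/
lemma measurable_countOn_section {Θ : Type*} [MeasurableSpace Θ] (n : ℕ)
    {A : Set (Θ × MarkedPlane)} (hA : MeasurableSet A) :
    Measurable fun ω : PointConfig × Θ => countOn n ω.1 (Prod.mk ω.2 ⁻¹' A) := by
  induction A, hA using MeasurableSpace.induction_on_inter generateFrom_prod.symm
    isPiSystem_prod with
  | empty => simp
  | basic A hA =>
    obtain ⟨S, hS, B, hB, rfl⟩ := hA
    have h : (fun ω : PointConfig × Θ => countOn n ω.1 (Prod.mk ω.2 ⁻¹' S ×ˢ B)) =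
        Set.indicator (Prod.snd ⁻¹' S) fun ω => countOn n ω.1 B := by
      classical
      funext ω
      by_cases h : ω.2 ∈ S <;> simp [h]
    rw [h]
    exact ((measurable_countOn n hB).comp measurable_fst).indicator (measurable_snd hS)
  | compl A hA ih =>
    simp_rw [Set.preimage_compl, measure_compl (measurable_prodMk_left hA) (measure_ne_top _ _)]
    exact ((measurable_countOn n MeasurableSet.univ).comp measurable_fst).sub ih
  | iUnion f hfd hfm ih =>
    have (ω : PointConfig × Θ) : countOn n ω.1 (Prod.mk ω.2 ⁻¹' ⋃ i, f i) =
        ∑' i, countOn n ω.1 (Prod.mk ω.2 ⁻¹' f i) := by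
      rw [Set.preimage_iUnion, measure_iUnion]
      exacts [hfd.mono fun _ _ ↦ .preimage _, fun i ↦ measurable_prodMk_left (hfm i)]
    simpa only [this] using Measurable.tsum ih

/-- The event that some point of the configuration has a given property, which may depend on
further randomness, is measurable. -/
lemma measurableSet_exists_mem {Θ : Type*} [MeasurableSpace Θ] {A : Set (Θ × MarkedPlane)}
    (hA : MeasurableSet A) :
    MeasurableSet {ω : PointConfig × Θ | ∃ p ∈ ω.1.1, (ω.2, p) ∈ A} := by
  have h : {ω : PointConfig × Θ | ∃ p ∈ ω.1.1, (ω.2, p) ∈ A} =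
      ⋃ n, {ω | countOn n ω.1 (Prod.mk ω.2 ⁻¹' A) ≠ 0} := by
    ext ω
    simp only [Set.mem_ofPred_eq, Set.mem_iUnion]
    have key : ∀ n, countOn n ω.1 (Prod.mk ω.2 ⁻¹' A) ≠ 0 ↔
        ∃ p, p ∈ ω.1.1 ∧ p ∈ cylinder n ∧ (ω.2, p) ∈ A := by
      intro n
      rw [countOn_apply n _ (measurable_prodMk_left hA), Ne, ENat.toENNReal_eq_zero,
        Set.encard_eq_zero, ← Ne, ← Set.nonempty_iff_ne_empty]
      exact Iff.rfl
    simp_rw [key]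
    constructor
    · rintro ⟨p, hp, hpA⟩
      obtain ⟨n, hn⟩ := exists_mem_cylinder p
      exact ⟨n, p, hp, hn, hpA⟩
    · rintro ⟨n, p, hp, -, hpA⟩
      exact ⟨p, hp, hpA⟩
  rw [h]
  exact MeasurableSet.iUnion fun n =>
    (measurable_countOn_section n hA) (measurableSet_singleton 0).compl

end Configurations

/-! ### Uniqueness of the Poisson law. -/

section PoissonUniqueness

/-- Bounded Borel sets. -/
def IsBoundedBorel (B : Set MarkedPlane) : Prop := MeasurableSet B ∧ ∃ n, B ⊆ cylinder n

/-- The events prescribing the numbers of points in finitely many bounded Borel sets. -/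
def countEvents : Set (Set PointConfig) :=
  {A | ∃ (ι : Type) (_ : Fintype ι) (B : ι → Set MarkedPlane) (k : ι → ℕ),
    (∀ i, IsBoundedBorel (B i)) ∧ A = {s | ∀ i, (s.1 ∩ B i).encard = k i}}

lemma isPiSystem_countEvents : IsPiSystem countEvents := by
  rintro _ ⟨ι, _, B, k, hB, rfl⟩ _ ⟨κ, _, C, l, hC, rfl⟩ -
  refine ⟨ι ⊕ κ, inferInstance, Sum.elim B C, Sum.elim k l, ?_, ?_⟩
  · rintro (i | i)
    exacts [hB i, hC i]
  · ext s
    simp [Sum.forall]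

/-- An arbitrary Borel set contains exactly `k` points if and only if its intersections with the
cylinders eventually do, so bounded sets suffice. -/
lemma generateFrom_countEvents :
    (inferInstance : MeasurableSpace PointConfig) = MeasurableSpace.generateFrom countEvents := by
  apply le_antisymm
  · refine MeasurableSpace.generateFrom_le ?_
    rintro _ ⟨B, k, hB, rfl⟩
    have hmeas : ∀ n : ℕ, MeasurableSet[MeasurableSpace.generateFrom countEvents]
        {s : PointConfig | (s.1 ∩ (cylinder n ∩ B)).encard = k} := fun n =>
      MeasurableSpace.measurableSet_generateFrom
        ⟨Unit, inferInstance, fun _ => cylinder n ∩ B, fun _ => k,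
          fun _ => ⟨(measurableSet_cylinder n).inter hB, n, Set.inter_subset_left⟩, by
            ext s; simp⟩
    have h : {s : PointConfig | (s.1 ∩ B).encard = k} =
        ⋃ m : ℕ, ⋂ n : ℕ, {s | m ≤ n → (s.1 ∩ (cylinder n ∩ B)).encard = k} := by
      ext s
      simp only [Set.mem_ofPred_eq, Set.mem_iUnion, Set.mem_iInter]
      have hmono : ∀ m n, m ≤ n → s.1 ∩ (cylinder m ∩ B) ⊆ s.1 ∩ (cylinder n ∩ B) :=
        fun m n hmn => Set.inter_subset_inter_right _
          (Set.inter_subset_inter_left _ (monotone_cylinder hmn))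
      have hfin_sub : ∀ t : Set MarkedPlane, t.Finite → t ⊆ s.1 ∩ B →
          ∃ m, t ⊆ s.1 ∩ (cylinder m ∩ B) := by
        intro t ht hts
        choose f hf using exists_mem_cylinder
        obtain ⟨M, hM⟩ := (ht.image f).bddAbove
        exact ⟨M, fun p hp => ⟨(hts hp).1,
          monotone_cylinder (hM (Set.mem_image_of_mem f hp)) (hf p), (hts hp).2⟩⟩
      have hle : ∀ n, s.1 ∩ (cylinder n ∩ B) ⊆ s.1 ∩ B := fun n p hp => ⟨hp.1, hp.2.2⟩
      constructor
      · intro hk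
        obtain ⟨m, hm⟩ := hfin_sub (s.1 ∩ B) (Set.finite_of_encard_eq_coe hk) le_rfl
        exact ⟨m, fun n hmn => by
          rw [← hk]
          exact congrArg _ ((hle n).antisymm (hm.trans (hmono m n hmn)))⟩
      · rintro ⟨m, hm⟩
        have hsub : s.1 ∩ B ⊆ s.1 ∩ (cylinder m ∩ B) := by
          intro p hp
          obtain ⟨j, hj⟩ := hfin_sub {p} (Set.finite_singleton p) (by simpa using hp)
          have h1 : p ∈ s.1 ∩ (cylinder (max m j) ∩ B) :=
            hmono j _ (le_max_right _ _) (hj rfl)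
          -- Nested finite sets with the same number of elements coincide, so no point of `B`
          -- appears after stage `m`.
          have h2 : s.1 ∩ (cylinder m ∩ B) = s.1 ∩ (cylinder (max m j) ∩ B) :=
            Set.Finite.eq_of_subset_of_encard_le
              (Set.finite_of_encard_eq_coe (hm m le_rfl))
              (hmono m _ (le_max_left _ _))
              (by rw [hm _ (le_max_left m j), hm m le_rfl])
          rw [h2]
          exact h1
        rw [← hm m le_rfl]
        exact congrArg _ (hsub.antisymm (hle m))
    rw [h]
    refine MeasurableSet.iUnion fun m => MeasurableSet.iInter fun n => ?_
    by_cases hmn : m ≤ n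
    · simpa only [hmn, true_imp_iff] using hmeas n
    · simp only [hmn, false_imp_iff]
      exact MeasurableSet.univ
  · refine MeasurableSpace.generateFrom_le ?_
    rintro _ ⟨ι, _, B, k, hB, rfl⟩
    rw [Set.ofPred_forall]
    exact MeasurableSet.iInter fun i => measurableSet_encard_eq (hB i).1 (k i)

lemma IsBoundedBorel.volume_lt_top {B : Set MarkedPlane} (hB : IsBoundedBorel B) :
    volume B < ∞ := by
  obtain ⟨n, hn⟩ := hB.2
  exact (measure_mono hn).trans_lt (isCompact_cylinder n).measure_lt_top

lemma IsBoundedBorel.finite_inter {B : Set MarkedPlane} (hB : IsBoundedBorel B)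
    (s : PointConfig) : (s.1 ∩ B).Finite := by
  obtain ⟨n, hn⟩ := hB.2
  exact (s.finite_inter_cylinder n).subset (Set.inter_subset_inter_right _ hn)

lemma IsPoissonLaw.apply_fintype {l : ℝ≥0} {P : Measure PointConfig} (hP : IsPoissonLaw l P)
    {ι : Type} [Fintype ι] (B : ι → Set MarkedPlane) (hB : ∀ i, IsBoundedBorel (B i))
    (hd : Pairwise fun i j => Disjoint (B i) (B j)) (k : ι → ℕ) :
    P {s : PointConfig | ∀ i, (s.1 ∩ B i).encard = k i} =
      ∏ i, poissonMeasure (l * (volume (B i)).toNNReal) {k i} := by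
  let e := Fintype.equivFin ι
  have h := hP (Fintype.card ι) (fun j => B (e.symm j)) (fun j => (hB _).1)
    (fun j => (hB _).volume_lt_top) (fun i j hij => hd (e.symm.injective.ne hij))
    (fun j => k (e.symm j))
  rw [e.symm.prod_comp (fun i => poissonMeasure (l * (volume (B i)).toNNReal) {k i})] at h
  rw [← h]
  congr 1
  ext s
  exact (e.symm.forall_congr_right (q := fun i => (s.1 ∩ B i).encard = k i)).symm

lemma IsPoissonLaw.isProbabilityMeasure {l : ℝ≥0} {P : Measure PointConfig}
    (hP : IsPoissonLaw l P) : IsProbabilityMeasure P := by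
  refine ⟨?_⟩
  have h := hP 0 (fun _ => ∅) (fun i => i.elim0) (fun i => i.elim0) (fun i => i.elim0)
    (fun _ => 0)
  simpa using h

/-- The Poisson law is unique. -/
lemma IsPoissonLaw.unique {l : ℝ≥0} {P P' : Measure PointConfig} (hP : IsPoissonLaw l P)
    (hP' : IsPoissonLaw l P') : P = P' := by
  have := hP.isProbabilityMeasure
  have := hP'.isProbabilityMeasure
  refine ext_of_generate_finite countEvents generateFrom_countEvents isPiSystem_countEvents ?_
    (by simp)
  rintro _ ⟨ι, _, B, k, hB, rfl⟩
  classical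
  -- The Poisson property only speaks of disjoint sets, whereas the sets of the π-system may
  -- overlap. They are cut into the atoms of the algebra they generate; the empty index set is left
  -- out because its atom, the complement of the union, is unbounded.
  let J := {J : Finset ι // J.Nonempty}
  let atom : J → Set MarkedPlane := fun J => {p | ∀ i, p ∈ B i ↔ i ∈ J.1}
  have hatom_sub : ∀ (j : J) (i : ι), i ∈ j.1 → atom j ⊆ B i := fun j i hi p hp => (hp i).2 hi
  have hatom : ∀ j, IsBoundedBorel (atom j) := by
    intro j
    refine ⟨?_, ?_⟩
    · have : atom j = ⋂ i, if i ∈ j.1 then B i else (B i)ᶜ := by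
        ext p
        simp only [atom, Set.mem_ofPred_eq, Set.mem_iInter]
        refine forall_congr' fun i => ?_
        by_cases hi : i ∈ j.1 <;> simp [hi]
      rw [this]
      refine MeasurableSet.iInter fun i => ?_
      split_ifs
      exacts [(hB i).1, (hB i).1.compl]
    · obtain ⟨i, hi⟩ := j.2
      obtain ⟨n, hn⟩ := (hB i).2
      exact ⟨n, (hatom_sub j i hi).trans hn⟩
  have hdisj : Pairwise fun i j => Disjoint (atom i) (atom j) := by
    intro i j hij
    refine Set.disjoint_left.mpr fun p hp hp' => hij ?_
    exact Subtype.ext (Finset.ext fun a => (hp a).symm.trans (hp' a))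
  have hsum : ∀ (s : PointConfig) (i : ι),
      (s.1 ∩ B i).encard = ∑ j : J, if i ∈ j.1 then (s.1 ∩ atom j).encard else 0 := by
    intro s i
    have hU : s.1 ∩ B i = ⋃ j : J, if i ∈ j.1 then s.1 ∩ atom j else ∅ := by
      ext p
      simp only [Set.mem_inter_iff, Set.mem_iUnion]
      constructor
      · rintro ⟨hs, hi⟩
        refine ⟨⟨Finset.univ.filter fun a => p ∈ B a, i, by simpa using hi⟩, ?_⟩
        simp [hi, hs, atom]
      · rintro ⟨j, hj⟩
        by_cases hi : i ∈ j.1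
        · rw [if_pos hi] at hj
          exact ⟨hj.1, hatom_sub j i hi hj.2⟩
        · simp [hi] at hj
    rw [hU, Set.encard_iUnion_of_finite, finsum_eq_sum_of_fintype]
    · refine Finset.sum_congr rfl fun j _ => ?_
      split_ifs <;> simp
    · intro a b hab
      simp only [Function.onFun]
      split_ifs
      · exact (hdisj hab).mono Set.inter_subset_right Set.inter_subset_right
      all_goals simp
  -- The event is the countable disjoint union, over all atom counts with the prescribed sums, of
  -- events to which the Poisson formula applies.
  let H := {h : J → ℕ // ∀ i, (∑ j : J, if i ∈ j.1 then h j else 0) = k i}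
  have hdecomp : {s : PointConfig | ∀ i, (s.1 ∩ B i).encard = k i} =
      ⋃ h : H, {s | ∀ j, (s.1 ∩ atom j).encard = h.1 j} := by
    ext s
    simp only [Set.mem_ofPred_eq, Set.mem_iUnion]
    constructor
    · intro hs
      have hc : ∀ j, (s.1 ∩ atom j).encard = ((s.1 ∩ atom j).ncard : ℕ) := fun j =>
        ((hatom j).finite_inter s).cast_ncard_eq.symm
      refine ⟨⟨fun j => (s.1 ∩ atom j).ncard, fun i => ?_⟩, hc⟩
      have h1 := hs i
      rw [hsum] at h1
      simp_rw [hc] at h1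
      exact_mod_cast h1
    · rintro ⟨h, hh⟩ i
      rw [hsum]
      simp_rw [hh]
      exact_mod_cast h.2 i
  have hm : ∀ h : H, MeasurableSet {s : PointConfig | ∀ j, (s.1 ∩ atom j).encard = h.1 j} := by
    intro h
    rw [Set.ofPred_forall]
    exact MeasurableSet.iInter fun j => measurableSet_encard_eq (hatom j).1 _
  have hd : Pairwise (Function.onFun Disjoint
      fun h : H => {s : PointConfig | ∀ j, (s.1 ∩ atom j).encard = h.1 j}) := by
    intro a b hab
    refine Set.disjoint_left.mpr fun s hs hs' => hab ?_
    refine Subtype.ext (funext fun j => ?_)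
    have := (hs j).symm.trans (hs' j)
    exact_mod_cast this
  rw [hdecomp, measure_iUnion hd hm, measure_iUnion hd hm]
  refine tsum_congr fun h => ?_
  rw [hP.apply_fintype atom hatom hdisj, hP'.apply_fintype atom hatom hdisj]

end PoissonUniqueness

/-! ### Invariance of the occupied set under symmetries of the field. -/

section Symmetry

/-- The homeomorphism of `ℝ² × [0,1]` induced by an isometry of the plane. -/
noncomputable def markedIso (T : Plane ≃ᵢ Plane) : MarkedPlane ≃ₜ MarkedPlane :=
  T.toHomeomorph.prodCongr (Homeomorph.refl _)

/-- The image of a configuration under an isometry of the plane. -/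
def PointConfig.map (T : Plane ≃ᵢ Plane) (s : PointConfig) : PointConfig :=
  ⟨markedIso T '' s.1, fun K hK => by
    rw [← Set.image_inter_preimage]
    exact (s.2 _ ((markedIso T).isCompact_preimage.mpr hK)).image _⟩

lemma PointConfig.encard_map_inter (T : Plane ≃ᵢ Plane) (s : PointConfig) (B : Set MarkedPlane) :
    ((s.map T).1 ∩ B).encard = (s.1 ∩ markedIso T ⁻¹' B).encard := by
  rw [PointConfig.map, ← Set.image_inter_preimage, (markedIso T).injective.encard_image]

/-- Planar Lebesgue measure is a Hausdorff measure, hence invariant under every isometry. -/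
lemma measurePreserving_markedIso (T : Plane ≃ᵢ Plane) :
    MeasurePreserving (markedIso T) (volume : Measure MarkedPlane) volume := by
  have h := T.measurePreserving_euclideanHausdorffMeasure 2
  rw [EuclideanSpace.euclideanHausdorffMeasure_eq_volume 2] at h
  exact h.prod (MeasurePreserving.id volume)

lemma measurable_map (T : Plane ≃ᵢ Plane) : Measurable (PointConfig.map T) := by
  refine measurable_generateFrom ?_
  rintro _ ⟨B, k, hB, rfl⟩
  have : PointConfig.map T ⁻¹' {s | (s.1 ∩ B).encard = k} =
      {s | (s.1 ∩ markedIso T ⁻¹' B).encard = k} := by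
    ext s
    simp [PointConfig.encard_map_inter]
  rw [this]
  exact measurableSet_encard_eq ((markedIso T).continuous.measurable hB) k

/-- Preimages under the isometry keep disjointness and volume, so the image law is again Poisson
with the same intensity, and uniqueness applies. -/
lemma IsPoissonLaw.measurePreserving_map {l : ℝ≥0} {P : Measure PointConfig}
    (hP : IsPoissonLaw l P) (T : Plane ≃ᵢ Plane) : MeasurePreserving (PointConfig.map T) P P := by
  refine ⟨measurable_map T, IsPoissonLaw.unique (l := l) ?_ hP⟩
  intro m B hB hfin hd k
  have hpre : ∀ i, volume (markedIso T ⁻¹' B i) = volume (B i) := fun i =>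
    (measurePreserving_markedIso T).measure_preimage (hB i).nullMeasurableSet
  have h := hP m (fun i => markedIso T ⁻¹' B i)
    (fun i => (markedIso T).continuous.measurable (hB i)) (fun i => by rw [hpre]; exact hfin i)
    (fun i j hij => (hd hij).preimage _) k
  simp_rw [hpre] at h
  rw [← h, Measure.map_apply (measurable_map T)]
  · congr 1
    ext s
    simp [PointConfig.encard_map_inter]
  · rw [Set.ofPred_forall]
    exact MeasurableSet.iInter fun i => measurableSet_encard_eq (hB i) (k i)

variable {Θ : Type*} [MeasurableSpace Θ]

lemma measurable_field {φ : Θ → Plane → ℝ≥0} (hφ : Measurable (Function.uncurry φ)) :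
    Measurable φ :=
  measurable_pi_lambda _ fun _ => hφ.comp (measurable_id.prodMk measurable_const)

/-- Events that correspond to each other under a symmetry have the same probability. -/
lemma measure_eq_of_symmetry {l : ℝ≥0} {P : Measure PointConfig} (hP : IsPoissonLaw l P)
    {Q : Measure Θ} [IsProbabilityMeasure Q] {φ : Θ → Plane → ℝ≥0}
    (hφ : Measurable (Function.uncurry φ)) {T : Plane ≃ᵢ Plane}
    (hT : Q.map (fun θ x => φ θ (T x)) = Q.map φ) {E E' : PointConfig → (Plane → ℝ≥0) → Prop}
    (hEr : ∀ s, MeasurableSet {r | E s r}) (hE : MeasurableSet {ω : PointConfig × Θ | E ω.1 (φ ω.2)})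
    (hE' : MeasurableSet {ω : PointConfig × Θ | E' ω.1 (φ ω.2)})
    (h : ∀ s r, E s (r ∘ T) ↔ E' (s.map T) r) :
    (P.prod Q) {ω | E ω.1 (φ ω.2)} = (P.prod Q) {ω | E' ω.1 (φ ω.2)} := by
  have := hP.isProbabilityMeasure
  have hpres := (hP.measurePreserving_map T).prod (MeasurePreserving.id Q)
  -- First the points are moved, which preserves `P`. Then, for each fixed configuration, the field
  -- is moved; there the event is measurable for the evaluation maps, so only the law of `φ` enters.
  rw [← hpres.measure_preimage hE'.nullMeasurableSet, Measure.prod_apply hE,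
    Measure.prod_apply (hpres.measurable hE')]
  refine lintegral_congr fun s => ?_
  have h1 : Prod.mk s ⁻¹' {ω : PointConfig × Θ | E ω.1 (φ ω.2)} = φ ⁻¹' {r | E s r} := rfl
  have h2 : Prod.mk s ⁻¹' (Prod.map (PointConfig.map T) id ⁻¹'
      {ω : PointConfig × Θ | E' ω.1 (φ ω.2)}) = (fun θ x => φ θ (T x)) ⁻¹' {r | E s r} := by
    ext θ
    exact (h s (φ θ)).symm
  have hm : Measurable fun θ x => φ θ (T x) :=
    measurable_pi_lambda _ fun x => hφ.comp (measurable_id.prodMk measurable_const)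
  rw [h1, h2, ← Measure.map_apply (measurable_field hφ) (hEr s), ← Measure.map_apply hm (hEr s), hT]

lemma occupied_comp (T : Plane ≃ᵢ Plane) (s : PointConfig) (r : Plane → ℝ≥0) :
    occupied s (r ∘ T) = T ⁻¹' occupied (s.map T) r := by
  ext y
  simp only [occupied, Set.mem_iUnion, Set.mem_preimage, Metric.mem_closedBall, exists_prop,
    PointConfig.map, Set.exists_mem_image, Function.comp_apply]
  refine exists_congr fun p => and_congr_right fun _ => ?_
  have : (markedIso T p).1 = T p.1 := rfl
  rw [this, T.isometry.dist_eq]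

lemma measurableSet_mem_occupied {φ : Θ → Plane → ℝ≥0} (hφ : Measurable (Function.uncurry φ))
    (x : Plane) : MeasurableSet {ω : PointConfig × Θ | x ∈ occupied ω.1 (φ ω.2)} := by
  have hA : MeasurableSet {a : Θ × MarkedPlane | dist x a.2.1 ≤ (φ a.1 a.2.1 : ℝ)} := by
    refine measurableSet_le (by fun_prop) ?_
    exact measurable_coe_nnreal_real.comp
      (hφ.comp (measurable_fst.prodMk (measurable_fst.comp measurable_snd)))
  convert measurableSet_exists_mem hA using 1
  ext ω
  simp [occupied]

lemma measurableSet_mem_occupied_config (s : PointConfig) (x : Plane) :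
    MeasurableSet {r : Plane → ℝ≥0 | x ∈ occupied s r} := by
  have : {r : Plane → ℝ≥0 | x ∈ occupied s r} =
      ⋃ p ∈ s.1, {r : Plane → ℝ≥0 | dist x p.1 ≤ (r p.1 : ℝ)} := by
    ext r
    simp [occupied]
  rw [this]
  refine MeasurableSet.biUnion s.countable fun p _ => measurableSet_le measurable_const ?_
  exact measurable_coe_nnreal_real.comp (measurable_pi_apply _)

lemma measurable_windowSigma {α : Type*} [MeasurableSpace α] {f : α → Set Plane} (K : Set Plane)
    (hf : ∀ x, MeasurableSet {a | x ∈ f a}) : Measurable[_, windowSigma K] f := by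
  refine measurable_iff_comap_le.mpr ?_
  simp only [windowSigma, MeasurableSpace.comap_iSup, MeasurableSpace.comap_comp]
  refine iSup₂_le fun x _ => ?_
  exact Measurable.comap_le (f := fun a => x ∈ f a) (measurable_to_prop (by
    have : (fun a => x ∈ f a) ⁻¹' {True} = {a | x ∈ f a} := by ext; simp
    rw [this]
    exact hf x))

lemma measurable_occupied {φ : Θ → Plane → ℝ≥0} (hφ : Measurable (Function.uncurry φ))
    (K : Set Plane) :
    Measurable[_, windowSigma K] fun ω : PointConfig × Θ => occupied ω.1 (φ ω.2) :=
  measurable_windowSigma K (measurableSet_mem_occupied hφ)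

/-- The law of the occupied set is invariant under symmetries of the field. -/
lemma measure_occupied_preimage {l : ℝ≥0} {P : Measure PointConfig} (hP : IsPoissonLaw l P)
    {Q : Measure Θ} [IsProbabilityMeasure Q] {φ : Θ → Plane → ℝ≥0}
    (hφ : Measurable (Function.uncurry φ)) {T : Plane ≃ᵢ Plane}
    (hT : Q.map (fun θ x => φ θ (T x)) = Q.map φ) {K : Set Plane} {S : Set (Set Plane)}
    (hS : MeasurableSet[windowSigma K] S) :
    (P.prod Q) {ω | occupied ω.1 (φ ω.2) ∈ S} =
      (P.prod Q) {ω | T ⁻¹' occupied ω.1 (φ ω.2) ∈ S} := by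
  refine measure_eq_of_symmetry hP hφ hT (E := fun s r => occupied s r ∈ S)
    (E' := fun s r => T ⁻¹' occupied s r ∈ S) (fun s => ?_) ?_ ?_ fun s r => ?_
  · exact measurable_windowSigma K (measurableSet_mem_occupied_config s) hS
  · exact measurable_occupied hφ K hS
  · exact measurable_windowSigma (f := fun ω : PointConfig × Θ => T ⁻¹' occupied ω.1 (φ ω.2)) K
      (fun x => measurableSet_mem_occupied hφ (T x)) hS
  · rw [occupied_comp]

end Symmetry

/-! ### The dichotomy: whole plane or locally finite discs. -/

section Dichotomy

/-- Arbitrarily distant points `p` of the configuration satisfy `‖p - c‖ ≤ r p + M`. -/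
def FarReach (M : ℝ) (c : Plane) (s : PointConfig) (r : Plane → ℝ≥0) : Prop :=
  ∀ n : ℕ, ∃ p ∈ s.1, (n : ℝ) < ‖p.1‖ ∧ ‖p.1 - c‖ ≤ r p.1 + M

lemma FarReach.mono {M M' : ℝ} {c c' : Plane} {s : PointConfig} {r : Plane → ℝ≥0}
    (h : FarReach M c s r) (hM : M + ‖c - c'‖ ≤ M') : FarReach M' c' s r := by
  intro n
  obtain ⟨p, hp, hn, hr⟩ := h n
  refine ⟨p, hp, hn, ?_⟩
  have := norm_sub_le_norm_sub_add_norm_sub p.1 c c'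
  linarith

lemma farReach_comp (M : ℝ) (c v : Plane) (s : PointConfig) (r : Plane → ℝ≥0) :
    FarReach M c s (r ∘ IsometryEquiv.addRight v) ↔
      FarReach M (c + v) (s.map (IsometryEquiv.addRight v)) r := by
  have key : ∀ p : MarkedPlane, (markedIso (IsometryEquiv.addRight v) p).1 = p.1 + v := fun p => rfl
  constructor
  · intro h n
    obtain ⟨p, hp, hn, hr⟩ := h (n + ⌈‖v‖⌉₊)
    refine ⟨_, ⟨p, hp, rfl⟩, ?_, ?_⟩
    · rw [key]
      have h1 := norm_sub_le (p.1 + v) v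
      have h2 := Nat.le_ceil ‖v‖
      rw [add_sub_cancel_right] at h1
      push_cast at hn
      linarith
    · rw [key, add_sub_add_right_eq_sub]
      exact hr
  · intro h n
    obtain ⟨_, ⟨p, hp, rfl⟩, hn, hr⟩ := h (n + ⌈‖v‖⌉₊)
    rw [key] at hn hr
    refine ⟨p, hp, ?_, ?_⟩
    · have h1 := norm_add_le p.1 v
      have h2 := Nat.le_ceil ‖v‖
      push_cast at hn
      linarith
    · rw [add_sub_add_right_eq_sub] at hr
      exact hr

/-- The four unit coordinate directions. -/
noncomputable def direction : Fin 2 × Bool → Plane := fun q => EuclideanSpace.single q.1 (if q.2 then 1 else -1)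

lemma norm_direction (q : Fin 2 × Bool) : ‖direction q‖ = 1 := by
  rw [direction, PiLp.norm_single]
  split_ifs <;> simp

/-- The larger coordinate is at least 7/10 of the norm, since 7/10 < 1/√2. Expanding the square, the
claim reduces to 0.4 L‖x‖ ≥ 0.75 L², which follows from ‖x‖ ≥ 2L. -/
lemma exists_direction (x : Plane) {L : ℝ} (hL : 0 < L) (hx : 2 * L ≤ ‖x‖) :
    ∃ q, ‖x - L • direction q‖ ≤ ‖x‖ - L / 2 := by
  have hn : ‖x‖ ^ 2 = x 0 ^ 2 + x 1 ^ 2 := by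
    rw [EuclideanSpace.norm_sq_eq, Fin.sum_univ_two, Real.norm_eq_abs, Real.norm_eq_abs, sq_abs,
      sq_abs]
  have hbig : ∃ i, (7 / 10) * ‖x‖ ≤ |x i| := by
    by_contra! hc
    have h0 := abs_lt.mp (hc 0)
    have h1 := abs_lt.mp (hc 1)
    nlinarith [sq_nonneg ‖x‖]
  obtain ⟨i, hi⟩ := hbig
  obtain ⟨b, hb⟩ : ∃ b : Bool, (if b then (1 : ℝ) else -1) * x i = |x i| := by
    rcases le_total 0 (x i) with h | h
    · exact ⟨true, by simp [abs_of_nonneg h]⟩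
    · exact ⟨false, by simp [abs_of_nonpos h]⟩
  refine ⟨(i, b), abs_le_of_sq_le_sq' ?_ (by linarith) |>.2⟩
  have hin : inner ℝ x (direction (i, b)) = |x i| := by
    rw [direction, EuclideanSpace.inner_single_right]
    simpa using hb
  rw [norm_sub_sq_real, inner_smul_right, hin, norm_smul, norm_direction, mul_one,
    Real.norm_eq_abs, sq_abs]
  nlinarith

/-- Moving the centre by `L` towards a distant point gains at least `L / 2`. With only four
directions available, one of them serves arbitrarily distant points. -/
lemma FarReach.exists_direction {M L : ℝ} (hL : 0 < L) {s : PointConfig} {r : Plane → ℝ≥0}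
    (h : FarReach M 0 s r) : ∃ q, FarReach (M - L / 2) (L • direction q) s r := by
  by_contra! hc
  simp only [FarReach, not_forall] at hc
  choose n hn using hc
  obtain ⟨p, hp, hpn, hpr⟩ := h (Finset.univ.sup n + ⌈2 * L⌉₊)
  have h2 := Nat.le_ceil (2 * L)
  push_cast at hpn
  have h3 : (0 : ℝ) ≤ (Finset.univ.sup n : ℕ) := Nat.cast_nonneg _
  have h4 : (0 : ℝ) ≤ (⌈2 * L⌉₊ : ℕ) := Nat.cast_nonneg _
  obtain ⟨q, hq⟩ := GilbertDisc.exists_direction p.1 hL (by linarith)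
  refine hn q ⟨p, hp, ?_, ?_⟩
  · have h5 : (n q : ℝ) ≤ (Finset.univ.sup n : ℕ) := by
      exact_mod_cast Finset.le_sup (f := n) (Finset.mem_univ q)
    linarith
  · rw [sub_zero] at hpr
    linarith

variable {Θ : Type*} [MeasurableSpace Θ]

lemma measurableSet_farReach {φ : Θ → Plane → ℝ≥0} (hφ : Measurable (Function.uncurry φ))
    (M : ℝ) (c : Plane) : MeasurableSet {ω : PointConfig × Θ | FarReach M c ω.1 (φ ω.2)} := by
  simp only [FarReach, Set.ofPred_forall]
  refine MeasurableSet.iInter fun n => ?_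
  have hA : MeasurableSet {a : Θ × MarkedPlane | (n : ℝ) < ‖a.2.1‖ ∧
      ‖a.2.1 - c‖ ≤ (φ a.1 a.2.1 : ℝ) + M} := by
    have h1 : Measurable fun a : Θ × MarkedPlane => ‖a.2.1‖ := by fun_prop
    have h2 : Measurable fun a : Θ × MarkedPlane => ‖a.2.1 - c‖ := by fun_prop
    refine (measurableSet_lt measurable_const h1).inter
      (measurableSet_le h2 (Measurable.add_const ?_ M))
    exact measurable_coe_nnreal_real.comp
      (hφ.comp (measurable_fst.prodMk (measurable_fst.comp measurable_snd)))
  exact measurableSet_exists_mem hA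

lemma measurableSet_farReach_config (M : ℝ) (c : Plane) (s : PointConfig) :
    MeasurableSet {r : Plane → ℝ≥0 | FarReach M c s r} := by
  have : {r : Plane → ℝ≥0 | FarReach M c s r} = ⋂ n : ℕ, ⋃ p ∈ s.1,
      {r : Plane → ℝ≥0 | (n : ℝ) < ‖p.1‖ ∧ ‖p.1 - c‖ ≤ (r p.1 : ℝ) + M} := by
    ext r
    simp only [FarReach, Set.mem_ofPred_eq, Set.mem_iInter, Set.mem_iUnion, exists_prop]
  rw [this]
  refine MeasurableSet.iInter fun n => MeasurableSet.biUnion s.countable fun p _ => ?_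
  refine (MeasurableSet.const _).inter (measurableSet_le measurable_const (Measurable.add_const ?_ M))
  exact measurable_coe_nnreal_real.comp (measurable_pi_apply _)

lemma measure_farReach {l : ℝ≥0} {P : Measure PointConfig} (hP : IsPoissonLaw l P)
    {Q : Measure Θ} [IsProbabilityMeasure Q] {φ : Θ → Plane → ℝ≥0}
    (hφ : Measurable (Function.uncurry φ)) (hstat : IsStationaryField Q φ) (M : ℝ) (c : Plane) :
    (P.prod Q) {ω | FarReach M c ω.1 (φ ω.2)} = (P.prod Q) {ω | FarReach M 0 ω.1 (φ ω.2)} := by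
  symm
  refine measure_eq_of_symmetry hP hφ (T := IsometryEquiv.addRight c) (hstat c)
    (measurableSet_farReach_config M 0) (measurableSet_farReach hφ M 0)
    (measurableSet_farReach hφ M c) fun s r => ?_
  have := farReach_comp M 0 c s r
  rwa [zero_add] at this

/-- Almost surely the discs are either locally finite, or arbitrarily distant ones contain any
given bounded set. -/
lemma ae_farReach_or {l : ℝ≥0} {P : Measure PointConfig} (hP : IsPoissonLaw l P)
    {Q : Measure Θ} [IsProbabilityMeasure Q] {φ : Θ → Plane → ℝ≥0}
    (hφ : Measurable (Function.uncurry φ)) (hstat : IsStationaryField Q φ) :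
    ∀ᵐ ω ∂(P.prod Q), (∀ k : ℕ, FarReach (-(k : ℝ)) 0 ω.1 (φ ω.2)) ∨
      ∀ k : ℕ, ¬ FarReach k 0 ω.1 (φ ω.2) := by
  have := hP.isProbabilityMeasure
  set μ := P.prod Q
  let F : ℝ → Plane → Set (PointConfig × Θ) := fun M c => {ω | FarReach M c ω.1 (φ ω.2)}
  let G : Set (PointConfig × Θ) := ⋂ k : ℕ, F (-(k : ℝ)) 0
  have hF : ∀ M c, MeasurableSet (F M c) := measurableSet_farReach hφ
  have hG : MeasurableSet G := MeasurableSet.iInter fun k => hF _ _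
  -- Moving the centre to `c` costs at most `‖c‖`, which the arbitrarily negative margins in `G`
  -- absorb.
  have hGsub : ∀ M c, G ⊆ F M c := by
    intro M c ω hω
    have h1 := Set.mem_iInter.mp hω ⌈‖c‖ - M⌉₊
    refine FarReach.mono h1 ?_
    rw [zero_sub, norm_neg]
    linarith [Nat.le_ceil (‖c‖ - M)]
  have hlim : Tendsto (fun k : ℕ => μ (F (-(k : ℝ)) 0 \ G)) atTop (𝓝 0) := by
    have h1 : Tendsto (fun k : ℕ => μ (F (-(k : ℝ)) 0 \ G)) atTop
        (𝓝 (μ (⋂ k : ℕ, F (-(k : ℝ)) 0 \ G))) := by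
      refine tendsto_measure_iInter_atTop (fun k => ((hF _ _).diff hG).nullMeasurableSet) ?_
        ⟨0, measure_ne_top _ _⟩
      intro i j hij ω hω
      refine ⟨FarReach.mono hω.1 ?_, hω.2⟩
      have : (i : ℝ) ≤ j := by exact_mod_cast hij
      simpa using this
    have h2 : ⋂ k : ℕ, F (-(k : ℝ)) 0 \ G = ∅ := by
      refine Set.eq_empty_of_forall_notMem fun ω hω => ?_
      have hω' := Set.mem_iInter.mp hω
      exact (hω' 0).2 (Set.mem_iInter.mpr fun k => (hω' k).1)
    rwa [h2, measure_empty] at h1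
  have hmain : ∀ j : ℕ, μ (F j 0 \ G) = 0 := by
    intro j
    have hbound : ∀ k : ℕ, μ (F j 0 \ G) ≤ 4 * μ (F (-((k + 1 : ℕ) : ℝ)) 0 \ G) := by
      intro k
      -- The shift is chosen so that the gain `L / 2` lowers the margin from `j` to `-(k + 1)`. The
      -- price is the factor 4, independent of `k`.
      set L : ℝ := 2 * (j + (k + 1 : ℕ)) with hL
      have hLpos : 0 < L := by rw [hL]; push_cast; positivity
      have hM : (j : ℝ) - L / 2 = -((k + 1 : ℕ) : ℝ) := by rw [hL]; ring
      have hsub : F j 0 \ G ⊆ ⋃ q, F (-((k + 1 : ℕ) : ℝ)) (L • direction q) \ G := by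
        rintro ω ⟨hω, hωG⟩
        obtain ⟨q, hq⟩ := FarReach.exists_direction hLpos hω
        rw [hM] at hq
        exact Set.mem_iUnion.mpr ⟨q, hq, hωG⟩
      calc μ (F j 0 \ G) ≤ μ (⋃ q, F (-((k + 1 : ℕ) : ℝ)) (L • direction q) \ G) :=
            measure_mono hsub
        _ ≤ ∑ q, μ (F (-((k + 1 : ℕ) : ℝ)) (L • direction q) \ G) := measure_iUnion_fintype_le _ _
        _ = ∑ _q : Fin 2 × Bool, μ (F (-((k + 1 : ℕ) : ℝ)) 0 \ G) := by
            refine Finset.sum_congr rfl fun q _ => ?_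
            -- Since `G` lies in both events, the differences can be compared by stationarity of the
            -- events alone; invariance of `G` is not required.
            rw [measure_sdiff (hGsub _ _) hG.nullMeasurableSet (measure_ne_top _ _),
              measure_sdiff (hGsub _ _) hG.nullMeasurableSet (measure_ne_top _ _)]
            exact congrArg (· - μ G) (measure_farReach hP hφ hstat _ _)
        _ = 4 * μ (F (-((k + 1 : ℕ) : ℝ)) 0 \ G) := by simp
    have h3 : Tendsto (fun k : ℕ => 4 * μ (F (-((k + 1 : ℕ) : ℝ)) 0 \ G)) atTop (𝓝 (4 * 0)) :=
      ENNReal.Tendsto.const_mul (hlim.comp (tendsto_add_atTop_nat 1)) (Or.inr (by simp))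
    rw [mul_zero] at h3
    exact le_antisymm (ge_of_tendsto' h3 hbound) bot_le
  have hall : ∀ᵐ ω ∂μ, ∀ j : ℕ, ω ∉ F j 0 \ G := ae_all_iff.mpr fun j =>
    measure_eq_zero_iff_ae_notMem.mp (hmain j)
  filter_upwards [hall] with ω hω
  by_cases hg : ω ∈ G
  · exact Or.inl fun k => Set.mem_iInter.mp hg k
  · exact Or.inr fun k hk => hω k ⟨hk, hg⟩

/-- Almost surely the occupied set is the plane or a locally finite union of discs. -/
lemma ae_occupied {l : ℝ≥0} {P : Measure PointConfig} (hP : IsPoissonLaw l P)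
    {Q : Measure Θ} [IsProbabilityMeasure Q] {φ : Θ → Plane → ℝ≥0}
    (hφ : Measurable (Function.uncurry φ)) (hstat : IsStationaryField Q φ) :
    ∀ᵐ ω ∂(P.prod Q), occupied ω.1 (φ ω.2) = Set.univ ∨
      ∀ k : ℕ, {p ∈ ω.1.1 | ‖p.1‖ ≤ φ ω.2 p.1 + k}.Finite := by
  filter_upwards [ae_farReach_or hP hφ hstat] with ω hω
  refine hω.imp (fun h => ?_) (fun h k => ?_)
  · refine Set.eq_univ_of_forall fun y => ?_
    obtain ⟨p, hp, -, hr⟩ := h ⌈‖y‖⌉₊ 0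
    refine Set.mem_biUnion hp ?_
    rw [Metric.mem_closedBall, dist_eq_norm]
    rw [sub_zero] at hr
    linarith [norm_sub_le y p.1, Nat.le_ceil ‖y‖]
  · have hk := h k
    simp only [FarReach, not_forall, not_exists, not_and] at hk
    obtain ⟨n, hn⟩ := hk
    refine (ω.1.finite_inter_cylinder n).subset fun p hp => ⟨hp.1, ?_⟩
    by_contra hc
    exact hn p hp.1 (not_le.mp hc) (by rw [sub_zero]; exact hp.2)

end Dichotomy

/-! ### Replacing crossings by countably determined separation events. -/

section Separation

/-- Some point of `L` is joined to some point of `L'` inside `O ∩ R`. -/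
def Conn (O R L L' : Set Plane) : Prop := ∃ x ∈ L, ∃ y ∈ L', JoinedIn (O ∩ R) x y

/-- A compact convex region `R` with two disjoint nonempty closed parts `L` and `L'`. -/
structure IsQuad (R L L' : Set Plane) : Prop where
  compact : IsCompact R
  convex : Convex ℝ R
  closed_left : IsClosed L
  closed_right : IsClosed L'
  left_subset : L ⊆ R
  right_subset : L' ⊆ R
  left_nonempty : L.Nonempty
  right_nonempty : L'.Nonempty
  disjoint : Disjoint L L'

/-- The union of the closed balls of radius `1/(k+1)` around finitely many members of a fixed dense
sequence. -/
def netBalls (F : Finset ℕ) (k : ℕ) : Set Plane :=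
  ⋃ i ∈ F, Metric.closedBall (TopologicalSpace.denseSeq Plane i) (1 / ((k : ℝ) + 1))

lemma isClosed_netBalls (F : Finset ℕ) (k : ℕ) : IsClosed (netBalls F k) :=
  F.finite_toSet.isClosed_biUnion fun _ _ => Metric.isClosed_closedBall

/-- `O` has a separation between `L` and `L'` near `R`, visible on a countable subset of `K`. -/
def sepEvent (K R L L' : Set Plane) : Set (Set Plane) :=
  {O | ∃ (F G : Finset ℕ) (k m : ℕ), (Metric.thickening (1 / ((m : ℝ) + 1)) R ⊆ K ∧
    L ⊆ netBalls F k ∧ L' ⊆ netBalls G k ∧ Disjoint (netBalls F k) (netBalls G k)) ∧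
    ∀ n, TopologicalSpace.denseSeq Plane n ∈ Metric.thickening (1 / ((m : ℝ) + 1)) R →
      TopologicalSpace.denseSeq Plane n ∈ O →
        TopologicalSpace.denseSeq Plane n ∈ netBalls F k ∪ netBalls G k}

lemma measurableSet_mem_windowSigma {K : Set Plane} {x : Plane} (hx : x ∈ K) :
    MeasurableSet[windowSigma K] {O : Set Plane | x ∈ O} := by
  have h : MeasurableSpace.comap (fun O : Set Plane => x ∈ O) ⊤ ≤ windowSigma K :=
    le_iSup₂ (f := fun x (_ : x ∈ K) => MeasurableSpace.comap (fun O : Set Plane => x ∈ O) ⊤) x hx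
  refine h _ ⟨{True}, trivial, ?_⟩
  ext O
  simp

lemma measurableSet_sepEvent (K R L L' : Set Plane) :
    MeasurableSet[windowSigma K] (sepEvent K R L L') := by
  let _ : MeasurableSpace (Set Plane) := windowSigma K
  simp only [sepEvent, Set.ofPred_exists]
  refine MeasurableSet.iUnion fun F => MeasurableSet.iUnion fun G => MeasurableSet.iUnion fun k =>
    MeasurableSet.iUnion fun m => ?_
  by_cases hc : Metric.thickening (1 / ((m : ℝ) + 1)) R ⊆ K ∧
    L ⊆ netBalls F k ∧ L' ⊆ netBalls G k ∧ Disjoint (netBalls F k) (netBalls G k)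
  · simp only [hc, true_and, Set.ofPred_forall]
    refine MeasurableSet.iInter fun n => MeasurableSet.iInter fun hn => ?_
    by_cases hn' : TopologicalSpace.denseSeq Plane n ∈ netBalls F k ∪ netBalls G k
    · simp only [hn', implies_true]
      exact MeasurableSet.const _
    · simp only [hn', imp_false]
      exact (measurableSet_mem_windowSigma (hc.1 hn)).compl
  · simp only [hc, false_and]
    exact MeasurableSet.const _

/-- In a connected set with two points, no point outside a closed set is covered by countably many
points. -/
lemma subset_of_diff_countable {A C Z : Set Plane} (hA : IsPreconnected A) (hC : IsClosed C)
    (hAn : A.Nontrivial) (hZ : Z.Countable) (h : A \ C ⊆ Z) : A ⊆ C := by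
  intro a ha
  by_contra haC
  obtain ⟨b, hb, hba⟩ := hAn.exists_ne a
  obtain ⟨δ, hδ, hball⟩ := Metric.isOpen_iff.mp hC.isOpen_compl a haC
  have hd : 0 < dist b a := dist_pos.mpr hba
  have himg : IsPreconnected ((fun z => dist z a) '' A) :=
    hA.image _ (by fun_prop)
  -- Distances from `a` to points of the connected set fill an interval, and the small ones come
  -- from points outside `C`, hence from `Z`. A countable set cannot produce an interval.
  have hsub : Set.Ioo 0 (min δ (dist b a)) ⊆ (fun z => dist z a) '' Z := by
    intro ρ hρ
    have h1 : ρ ∈ Set.Icc (dist a a) (dist b a) := by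
      rw [dist_self]
      exact ⟨hρ.1.le, (lt_min_iff.mp hρ.2).2.le⟩
    obtain ⟨z, hz, hzρ⟩ := himg.Icc_subset ⟨a, ha, rfl⟩ ⟨b, hb, rfl⟩ h1
    refine ⟨z, h ⟨hz, hball ?_⟩, hzρ⟩
    rw [Metric.mem_ball]
    simp only at hzρ
    rw [hzρ]
    exact (lt_min_iff.mp hρ.2).1
  have hcount := (hZ.image fun z => dist z a).mono hsub
  have hlt : (0 : ℝ) < min δ (dist b a) := lt_min hδ hd
  have := Cardinal.mk_Ioo_real hlt
  rw [← Cardinal.le_aleph0_iff_set_countable, this] at hcount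
  exact absurd hcount (not_le.mpr Cardinal.aleph0_lt_continuum)

/-- A connection excludes a separation. -/
lemma not_mem_sepEvent_of_conn {K R L L' : Set Plane} {s : PointConfig} {r : Plane → ℝ≥0}
    (h : Conn (occupied s r) R L L') : occupied s r ∉ sepEvent K R L L' := by
  rintro ⟨F, G, k, m, ⟨-, hL, hL', hd⟩, hsep⟩
  obtain ⟨x, hx, y, hy, γ, hγ⟩ := h
  set C := netBalls F k ∪ netBalls G k with hC
  have hCc : IsClosed C := (isClosed_netBalls F k).union (isClosed_netBalls G k)
  have hconn : IsPreconnected (Set.range γ) := isPreconnected_range γ.continuous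
  have hxy : x ≠ y := by
    rintro rfl
    exact Set.disjoint_left.mp hd (hL hx) (hL' hy)
  have hxr : x ∈ Set.range γ := ⟨0, γ.source⟩
  have hyr : y ∈ Set.range γ := ⟨1, γ.target⟩
  have hZ : (Prod.fst '' s.1).Countable := s.countable.image _
  have hsub : Set.range γ \ C ⊆ Prod.fst '' s.1 := by
    rintro z ⟨⟨t, rfl⟩, hzC⟩
    obtain ⟨hO, hR⟩ := hγ t
    simp only [occupied, Set.mem_iUnion, exists_prop] at hO
    obtain ⟨p, hp, hball⟩ := hO
    -- Discs of radius zero may miss the dense sequence altogether, but they amount to only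
    -- countably many points.
    rcases eq_or_ne (r p.1) 0 with h0 | h0
    · rw [h0, NNReal.coe_zero, Metric.closedBall_zero, Set.mem_singleton_iff] at hball
      exact ⟨p, hp, hball.symm⟩
    · exfalso
      apply hzC
      set W := Metric.thickening (1 / ((m : ℝ) + 1)) R
      have hW : IsOpen W := Metric.isOpen_thickening
      have hzW : γ t ∈ W := Metric.self_subset_thickening (by positivity) R hR
      -- A disc of positive radius is the closure of its interior, which may touch `R` only from
      -- outside. The open neighbourhood `W` of `R` ensures that dense points of the disc accumulate
      -- at `γ t`.
      have hcl : γ t ∈ closure (W ∩ Metric.ball p.1 (r p.1)) := by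
        refine hW.inter_closure ⟨hzW, ?_⟩
        rwa [closure_ball _ (by exact_mod_cast h0)]
      have hcl2 : γ t ∈ closure (W ∩ Metric.ball p.1 (r p.1) ∩
          Set.range (TopologicalSpace.denseSeq Plane)) := by
        exact closure_minimal (Dense.open_subset_closure_inter (TopologicalSpace.denseRange_denseSeq Plane) (hW.inter Metric.isOpen_ball)) isClosed_closure hcl
      refine hCc.closure_subset_iff.mpr ?_ hcl2
      rintro _ ⟨⟨hw, hb⟩, n, rfl⟩
      exact hsep n hw (Set.mem_biUnion hp (Metric.ball_subset_closedBall hb))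
  have hsubC := subset_of_diff_countable hconn hCc ⟨x, hxr, y, hyr, hxy⟩ hZ hsub
  obtain ⟨w, -, hw1, hw2⟩ := isPreconnected_closed_iff.mp hconn _ _ (isClosed_netBalls F k)
    (isClosed_netBalls G k) hsubC ⟨x, hxr, hL hx⟩ ⟨y, hyr, hL' hy⟩
  exact Set.disjoint_left.mp hd hw1 hw2

/-- Compact sets are covered by the interiors of finitely many small net balls near them. -/
lemma exists_netBalls {A : Set Plane} (hA : IsCompact A) (k : ℕ) :
    ∃ F, A ⊆ interior (netBalls F k) ∧
      netBalls F k ⊆ Metric.cthickening (2 / ((k : ℝ) + 1)) A := by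
  have hk : (0 : ℝ) < 1 / ((k : ℝ) + 1) := by positivity
  let q := TopologicalSpace.denseSeq Plane
  let S : Set ℕ := {n | ∃ a ∈ A, dist (q n) a < 1 / ((k : ℝ) + 1)}
  have hcov : A ⊆ ⋃ n : S, Metric.ball (q n) (1 / ((k : ℝ) + 1)) := by
    intro a ha
    obtain ⟨n, hn⟩ := (TopologicalSpace.denseRange_denseSeq Plane).exists_dist_lt a hk
    exact Set.mem_iUnion.mpr ⟨⟨n, a, ha, by rwa [dist_comm]⟩, hn⟩
  obtain ⟨t, ht⟩ := hA.elim_finite_subcover _ (fun n => Metric.isOpen_ball) hcov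
  classical
  refine ⟨t.image Subtype.val, ?_, ?_⟩
  · refine ht.trans (Set.iUnion₂_subset fun n hn => ?_)
    refine interior_maximal ?_ Metric.isOpen_ball
    exact Metric.ball_subset_closedBall.trans
      (Set.subset_biUnion_of_mem (u := fun i => Metric.closedBall (q i) (1 / ((k : ℝ) + 1)))
        (Finset.mem_image_of_mem _ hn))
  · refine Set.iUnion₂_subset fun i hi z hz => ?_
    obtain ⟨⟨n, a, ha, hna⟩, -, rfl⟩ := Finset.mem_image.mp hi
    refine Metric.mem_cthickening_of_dist_le z a _ A ha ?_
    have h1 := dist_triangle z (q n) a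
    have h2 : dist z (q n) ≤ 1 / ((k : ℝ) + 1) := hz
    have h3 : 2 / ((k : ℝ) + 1) = 1 / ((k : ℝ) + 1) + 1 / ((k : ℝ) + 1) := by ring
    linarith

/-- In a finite union of convex compact sets, the set of points joined to `L`, and the set of those
not joined to `L`, are compact. -/
lemma isCompact_joined {ι : Type*} {I : Set ι} (hI : I.Finite) {C : ι → Set Plane}
    (hc : ∀ i, IsCompact (C i)) (hconv : ∀ i, Convex ℝ (C i)) {U : Set Plane}
    (hU : U = ⋃ i ∈ I, C i) (L : Set Plane) :
    IsCompact {x ∈ U | ∃ y ∈ L, JoinedIn U y x} ∧ IsCompact {x ∈ U | ¬ ∃ y ∈ L, JoinedIn U y x} := by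
  have hsub : ∀ i ∈ I, C i ⊆ U := fun i hi => hU ▸ Set.subset_biUnion_of_mem hi
  have hjoin : ∀ i ∈ I, ∀ x ∈ C i, ∀ z ∈ C i, (∃ y ∈ L, JoinedIn U y x) →
      ∃ y ∈ L, JoinedIn U y z := by
    rintro i hi x hx z hz ⟨y, hy, hj⟩
    exact ⟨y, hy, hj.trans
      ((((hconv i).isPathConnected ⟨x, hx⟩).joinedIn x hx z hz).mono (hsub i hi))⟩
  constructor
  · have : {x ∈ U | ∃ y ∈ L, JoinedIn U y x} =
        ⋃ i ∈ {i ∈ I | ∃ x ∈ C i, ∃ y ∈ L, JoinedIn U y x}, C i := by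
      ext z
      simp only [Set.mem_ofPred_eq, Set.mem_iUnion, exists_prop]
      constructor
      · rintro ⟨hz, hj⟩
        rw [hU] at hz
        simp only [Set.mem_iUnion, exists_prop] at hz
        obtain ⟨i, hi, hzi⟩ := hz
        exact ⟨i, ⟨hi, z, hzi, hj⟩, hzi⟩
      · rintro ⟨i, ⟨hi, x, hx, hj⟩, hz⟩
        exact ⟨hsub i hi hz, hjoin i hi x hx z hz hj⟩
    rw [this]
    exact (hI.subset (Set.sep_subset _ _)).isCompact_biUnion fun i _ => hc i
  · have : {x ∈ U | ¬ ∃ y ∈ L, JoinedIn U y x} =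
        ⋃ i ∈ {i ∈ I | ∀ x ∈ C i, ¬ ∃ y ∈ L, JoinedIn U y x}, C i := by
      ext z
      simp only [Set.mem_ofPred_eq, Set.mem_iUnion, exists_prop]
      constructor
      · rintro ⟨hz, hj⟩
        rw [hU] at hz
        simp only [Set.mem_iUnion, exists_prop] at hz
        obtain ⟨i, hi, hzi⟩ := hz
        exact ⟨i, ⟨hi, fun x hx hjx => hj (hjoin i hi x hx z hzi hjx)⟩, hzi⟩
      · rintro ⟨i, ⟨hi, hj⟩, hz⟩
        exact ⟨hsub i hi hz, hj z hz⟩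
    rw [this]
    exact (hI.subset (Set.sep_subset _ _)).isCompact_biUnion fun i _ => hc i

/-- For a locally finite union of discs, the absence of a connection gives a separation. -/
lemma mem_sepEvent_of_not_conn {K R L L' : Set Plane} (hq : IsQuad R L L') {δ₀ : ℝ} (hδ₀ : 0 < δ₀)
    (hK : Metric.thickening δ₀ R ⊆ K) {s : PointConfig} {r : Plane → ℝ≥0}
    (hfin : ∀ k : ℕ, {p ∈ s.1 | ‖p.1‖ ≤ r p.1 + k}.Finite)
    (h : ¬ Conn (occupied s r) R L L') : occupied s r ∈ sepEvent K R L L' := by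
  obtain ⟨B, hB⟩ := (hq.compact.isBounded.thickening (δ := 1)).exists_norm_le
  set j := ⌈B⌉₊
  -- `I` is finite and contains the centre of every disc that meets the 1-neighbourhood of `R`.
  set I := {p ∈ s.1 | ‖p.1‖ ≤ r p.1 + j} with hIdef
  have hI : I.Finite := hfin j
  have hmemI : ∀ x ∈ Metric.thickening 1 R, x ∈ occupied s r →
      ∃ p ∈ I, x ∈ Metric.closedBall p.1 (r p.1 : ℝ) := by
    intro x hx hxO
    simp only [occupied, Set.mem_iUnion, exists_prop] at hxO
    obtain ⟨p, hp, hpx⟩ := hxO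
    refine ⟨p, ⟨hp, ?_⟩, hpx⟩
    have h1 := hB x hx
    have h2 := Nat.le_ceil B
    rw [Metric.mem_closedBall, dist_eq_norm] at hpx
    have h3 := norm_sub_norm_le p.1 x
    rw [norm_sub_rev] at h3
    have h4 : (j : ℝ) = (⌈B⌉₊ : ℝ) := rfl
    linarith
  have hRthick : R ⊆ Metric.thickening 1 R := Metric.self_subset_thickening one_pos R
  set U := occupied s r ∩ R with hUdef
  have hU : U = ⋃ p ∈ I, (Metric.closedBall p.1 (r p.1 : ℝ) ∩ R) := by
    ext x
    simp only [Set.mem_iUnion, exists_prop, Set.mem_inter_iff, hUdef]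
    constructor
    · rintro ⟨hxO, hxR⟩
      obtain ⟨p, hp, hpx⟩ := hmemI x (hRthick hxR) hxO
      exact ⟨p, hp, hpx, hxR⟩
    · rintro ⟨p, hp, hpx, hxR⟩
      exact ⟨Set.mem_biUnion hp.1 hpx, hxR⟩
  obtain ⟨hA0, hB0⟩ := isCompact_joined hI
    (C := fun p : MarkedPlane => Metric.closedBall p.1 (r p.1 : ℝ) ∩ R)
    (fun p => (isCompact_closedBall _ _).inter hq.compact)
    (fun p => (convex_closedBall _ _).inter hq.convex) hU L
  set A0 := {x ∈ U | ∃ y ∈ L, JoinedIn U y x} with hA0def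
  set B0 := {x ∈ U | ¬ ∃ y ∈ L, JoinedIn U y x} with hB0def
  have hL : IsCompact L := hq.compact.of_isClosed_subset hq.closed_left hq.left_subset
  have hL' : IsCompact L' := hq.compact.of_isClosed_subset hq.closed_right hq.right_subset
  -- The two sides `L` and `L'` are added because the net balls have to cover them even where they
  -- are vacant.
  have hdisj : Disjoint (A0 ∪ L) (B0 ∪ L') := by
    refine Set.disjoint_left.mpr ?_
    rintro x (hx | hx) (hx' | hx')
    · exact hx'.2 hx.2
    · obtain ⟨y, hy, hj⟩ := hx.2
      exact h ⟨y, hy, x, hx', hj⟩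
    · exact hx'.2 ⟨x, hx, JoinedIn.refl hx'.1⟩
    · exact Set.disjoint_left.mp hq.disjoint hx hx'
  obtain ⟨δ, hδ, hdδ⟩ := hdisj.exists_cthickenings (hA0.union hL) (hB0.union hL').isClosed
  obtain ⟨k, hk⟩ := exists_nat_one_div_lt (half_pos hδ)
  have hk2 : 2 / ((k : ℝ) + 1) ≤ δ := by
    have : 2 / ((k : ℝ) + 1) = 2 * (1 / ((k : ℝ) + 1)) := by ring
    linarith
  obtain ⟨F, hF1, hF2⟩ := exists_netBalls (hA0.union hL) k
  obtain ⟨G, hG1, hG2⟩ := exists_netBalls (hB0.union hL') k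
  set V := interior (netBalls F k) ∪ interior (netBalls G k) with hV
  have hVo : IsOpen V := isOpen_interior.union isOpen_interior
  -- What the finitely many discs leave outside the net balls is compact and misses `R`, hence stays
  -- at a positive distance from it. A sufficiently thin neighbourhood of `R` therefore sees only
  -- covered points.
  have hCc : IsCompact ((⋃ p ∈ I, Metric.closedBall p.1 (r p.1 : ℝ)) \ V) :=
    (hI.isCompact_biUnion fun p _ => isCompact_closedBall _ _).diff hVo
  have hCR : Disjoint ((⋃ p ∈ I, Metric.closedBall p.1 (r p.1 : ℝ)) \ V) R := by
    refine Set.disjoint_left.mpr fun x hx hxR => hx.2 ?_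
    have hxU : x ∈ U := by
      rw [hU]
      obtain ⟨p, hp, hpx⟩ := Set.mem_iUnion₂.mp hx.1
      exact Set.mem_iUnion₂.mpr ⟨p, hp, hpx, hxR⟩
    by_cases hj : ∃ y ∈ L, JoinedIn U y x
    · exact Or.inl (hF1 (Or.inl ⟨hxU, hj⟩))
    · exact Or.inr (hG1 (Or.inl ⟨hxU, hj⟩))
  obtain ⟨η, hη, hηd⟩ := hCR.exists_thickenings hCc hq.compact.isClosed
  obtain ⟨m, hm⟩ := exists_nat_one_div_lt (lt_min hη (lt_min hδ₀ one_pos))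
  obtain ⟨hm1, hm2, hm3⟩ := (by simpa only [lt_min_iff] using hm :
    1 / ((m : ℝ) + 1) < η ∧ 1 / ((m : ℝ) + 1) < δ₀ ∧ 1 / ((m : ℝ) + 1) < 1)
  refine ⟨F, G, k, m, ⟨(Metric.thickening_mono hm2.le R).trans hK, ?_, ?_, ?_⟩, ?_⟩
  · exact Set.subset_union_right.trans (hF1.trans interior_subset)
  · exact Set.subset_union_right.trans (hG1.trans interior_subset)
  · exact hdδ.mono (hF2.trans (Metric.cthickening_mono hk2 _))
      (hG2.trans (Metric.cthickening_mono hk2 _))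
  · intro n hn hnO
    by_contra hnot
    obtain ⟨p, hp, hpx⟩ := hmemI _ (Metric.thickening_mono hm3.le R hn) hnO
    refine Set.disjoint_left.mp hηd (Metric.self_subset_thickening hη _
      ⟨Set.mem_iUnion₂.mpr ⟨p, hp, hpx⟩, fun hv => hnot ?_⟩) (Metric.thickening_mono hm1.le R hn)
    exact hv.imp (fun h => interior_subset h) (fun h => interior_subset h)

lemma conn_univ {R L L' : Set Plane} (hq : IsQuad R L L') : Conn Set.univ R L L' := by
  obtain ⟨x, hx⟩ := hq.left_nonempty
  obtain ⟨y, hy⟩ := hq.right_nonempty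
  refine ⟨x, hx, y, hy, ?_⟩
  rw [Set.univ_inter]
  exact (hq.convex.isPathConnected ⟨x, hq.left_subset hx⟩).joinedIn x (hq.left_subset hx) y
    (hq.right_subset hy)

end Separation

/-! ### Tame configurations. -/

section LocallyFinite

/-- The occupied set is the plane, or the discs are locally finite. -/
def IsTame (s : PointConfig) (r : Plane → ℝ≥0) : Prop :=
  occupied s r = Set.univ ∨ ∀ k : ℕ, {p ∈ s.1 | ‖p.1‖ ≤ r p.1 + k}.Finite

lemma PointConfig.map_map_symm (T : Plane ≃ᵢ Plane) (s : PointConfig) :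
    (s.map T.symm).map T = s := by
  refine Subtype.ext ?_
  simp only [PointConfig.map, Set.image_image]
  convert Set.image_id s.1 using 2 with p
  exact Prod.ext (T.apply_symm_apply p.1) rfl

lemma IsTame.comp {s : PointConfig} {r : Plane → ℝ≥0} (h : IsTame s r) (T : Plane ≃ᵢ Plane) :
    IsTame (s.map T.symm) (r ∘ T) := by
  refine h.imp (fun h => ?_) (fun h k => ?_)
  · rw [occupied_comp, PointConfig.map_map_symm, h, Set.preimage_univ]
  · refine ((h (k + ⌈‖T 0‖⌉₊)).image (markedIso T.symm)).subset ?_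
    rintro _ ⟨⟨p, hp, rfl⟩, hle⟩
    refine ⟨p, ⟨hp, ?_⟩, rfl⟩
    have h1 : (markedIso T.symm p).1 = T.symm p.1 := rfl
    rw [h1, Function.comp_apply, T.apply_symm_apply] at hle
    have h2 := dist_triangle p.1 (T 0) 0
    have h3 : dist p.1 (T 0) = ‖T.symm p.1‖ := by
      rw [← dist_zero_right, ← T.isometry.dist_eq (T.symm p.1) 0, T.apply_symm_apply]
    rw [h3, dist_zero_right, dist_zero_right] at h2
    have h4 := Nat.le_ceil ‖T 0‖
    push_cast
    linarith

lemma preimage_occupied (T : Plane ≃ᵢ Plane) (s : PointConfig) (r : Plane → ℝ≥0) :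
    T ⁻¹' occupied s r = occupied (s.map T.symm) (r ∘ T) := by
  rw [occupied_comp, PointConfig.map_map_symm]

/-- A connection always excludes a separation. Conversely, the whole plane connects everything, and
in the locally finite case a missing connection produces a separation. -/
lemma IsTame.conn_iff {K R L L' : Set Plane} (hq : IsQuad R L L') {δ₀ : ℝ} (hδ₀ : 0 < δ₀)
    (hK : Metric.thickening δ₀ R ⊆ K) {s : PointConfig} {r : Plane → ℝ≥0} (h : IsTame s r) :
    Conn (occupied s r) R L L' ↔ occupied s r ∈ (sepEvent K R L L')ᶜ := by
  refine ⟨not_mem_sepEvent_of_conn, fun hs => ?_⟩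
  rcases h with h | h
  · rw [h]
    exact conn_univ hq
  · by_contra hc
    exact hs (mem_sepEvent_of_not_conn hq hδ₀ hK h hc)

end LocallyFinite

/-! ### Probabilities of visible events and decorrelation. -/

section Probabilities

variable {Θ : Type*} [MeasurableSpace Θ]

/-- The standing assumptions: Poisson points and a stationary, right-angle invariant field. -/
structure IsModel (l : ℝ≥0) (P : Measure PointConfig) (Q : Measure Θ) (φ : Θ → Plane → ℝ≥0) :
    Prop where
  poisson : IsPoissonLaw l P
  isProb : IsProbabilityMeasure Q
  measurable : Measurable (Function.uncurry φ)
  stationary : IsStationaryField Q φ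
  rotInvariant : IsRotationInvariantField Q φ

variable {l : ℝ≥0} {P : Measure PointConfig} {Q : Measure Θ} {φ : Θ → Plane → ℝ≥0}

lemma IsModel.isProbabilityMeasure_prod (h : IsModel l P Q φ) : IsProbabilityMeasure (P.prod Q) := by
  have := h.poisson.isProbabilityMeasure
  have := h.isProb
  infer_instance

lemma IsModel.ae_isTame (h : IsModel l P Q φ) : ∀ᵐ ω ∂(P.prod Q), IsTame ω.1 (φ ω.2) := by
  have := h.isProb
  exact ae_occupied h.poisson h.measurable h.stationary

/-- The probability that the occupied set has a given property. -/
noncomputable def occProb (P : Measure PointConfig) (Q : Measure Θ) (φ : Θ → Plane → ℝ≥0)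
    (A : Set Plane → Prop) : ℝ :=
  (P.prod Q).real {ω | A (occupied ω.1 (φ ω.2))}

lemma occProb_nonneg (A : Set Plane → Prop) : 0 ≤ occProb P Q φ A := measureReal_nonneg

lemma IsModel.occProb_mono (h : IsModel l P Q φ) {A B : Set Plane → Prop} (hAB : ∀ O, A O → B O) :
    occProb P Q φ A ≤ occProb P Q φ B := by
  have := h.isProbabilityMeasure_prod
  exact measureReal_mono fun ω hω => hAB _ hω

/-- A property of the occupied set that, for tame configurations, is measurable with respect to the
indicators of `K`. -/
def IsVisible (K : Set Plane) (A : Set Plane → Prop) : Prop :=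
  ∃ S : Set (Set Plane), MeasurableSet[windowSigma K] S ∧
    ∀ s r, IsTame s r → (A (occupied s r) ↔ occupied s r ∈ S)

lemma IsVisible.not {K : Set Plane} {A : Set Plane → Prop} (h : IsVisible K A) :
    IsVisible K fun O => ¬ A O := by
  obtain ⟨S, hS, hA⟩ := h
  exact ⟨Sᶜ, hS.compl, fun s r hsr => not_congr (hA s r hsr)⟩

lemma IsQuad.isVisible {K R L L' : Set Plane} (hq : IsQuad R L L') {δ₀ : ℝ} (hδ₀ : 0 < δ₀)
    (hK : Metric.thickening δ₀ R ⊆ K) : IsVisible K fun O => Conn O R L L' :=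
  ⟨_, (measurableSet_sepEvent K R L L').compl, fun _ _ h => h.conn_iff hq hδ₀ hK⟩

/-- Almost every configuration is tame, so an event whose own measurability is unknown can be
exchanged for a measurable one. -/
lemma IsModel.occProb_congr (h : IsModel l P Q φ) {A : Set Plane → Prop} {S : Set (Set Plane)}
    (hA : ∀ s r, IsTame s r → (A (occupied s r) ↔ occupied s r ∈ S)) :
    occProb P Q φ A = occProb P Q φ (· ∈ S) := by
  refine measureReal_congr ?_
  filter_upwards [h.ae_isTame] with ω hω
  exact propext (hA _ _ hω)

lemma IsModel.occProb_not (h : IsModel l P Q φ) {K : Set Plane} {A : Set Plane → Prop}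
    (hA : IsVisible K A) : occProb P Q φ (fun O => ¬ A O) = 1 - occProb P Q φ A := by
  have := h.isProbabilityMeasure_prod
  obtain ⟨S, hS, hAS⟩ := hA
  rw [h.occProb_congr hAS, h.occProb_congr (S := Sᶜ) fun s r hsr => not_congr (hAS s r hsr)]
  exact probReal_compl_eq_one_sub (measurable_occupied h.measurable K hS)

/-- Tameness is stable under isometries, so the measurable substitute for `A` also represents the
transformed event. -/
lemma IsModel.occProb_preimage (h : IsModel l P Q φ) {T : Plane ≃ᵢ Plane}
    (hT : Q.map (fun θ x => φ θ (T x)) = Q.map φ) {K : Set Plane} {A : Set Plane → Prop}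
    (hA : IsVisible K A) : occProb P Q φ A = occProb P Q φ fun O => A (T ⁻¹' O) := by
  have := h.isProb
  obtain ⟨S, hS, hAS⟩ := hA
  have h2 : occProb P Q φ (fun O => A (T ⁻¹' O)) = occProb P Q φ fun O => T ⁻¹' O ∈ S := by
    refine h.occProb_congr (S := {O | T ⁻¹' O ∈ S}) fun s r hsr => ?_
    rw [preimage_occupied]
    have h3 := hAS _ _ (hsr.comp T)
    rw [h3, Set.mem_ofPred_eq, preimage_occupied]
  rw [h2, h.occProb_congr hAS]
  exact congrArg ENNReal.toReal (measure_occupied_preimage h.poisson h.measurable hT hS)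

lemma IsModel.integral_mem_Icc (h : IsModel l P Q φ) {f : PointConfig × Θ → ℝ}
    (hf : ∀ ω, f ω ∈ Set.Icc (0 : ℝ) 1) : ∫ ω, f ω ∂(P.prod Q) ∈ Set.Icc (0 : ℝ) 1 := by
  have := h.isProbabilityMeasure_prod
  refine ⟨integral_nonneg fun ω => (hf ω).1, ?_⟩
  have h1 := norm_integral_le_of_norm_le_const (μ := P.prod Q) (f := f) (C := 1)
    (Eventually.of_forall fun ω => by
      rw [Real.norm_eq_abs, abs_of_nonneg (hf ω).1]
      exact (hf ω).2)
  rw [probReal_univ, mul_one] at h1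
  exact (le_abs_self _).trans h1

lemma IsModel.abs_occCov_le (h : IsModel l P Q φ) {f g : Set Plane → ℝ}
    (hf : ∀ O, f O ∈ Set.Icc (0 : ℝ) 1) (hg : ∀ O, g O ∈ Set.Icc (0 : ℝ) 1) :
    |occCov P Q φ f g| ≤ 1 := by
  have h1 := h.integral_mem_Icc (f := fun ω => f (occupied ω.1 (φ ω.2))) fun ω => hf _
  have h2 := h.integral_mem_Icc (f := fun ω => g (occupied ω.1 (φ ω.2))) fun ω => hg _
  have h3 := h.integral_mem_Icc
    (f := fun ω => f (occupied ω.1 (φ ω.2)) * g (occupied ω.1 (φ ω.2)))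
    fun ω => ⟨mul_nonneg (hf _).1 (hg _).1, mul_le_one₀ (hf _).2 (hg _).1 (hg _).2⟩
  have h4 := mul_nonneg h1.1 h2.1
  have h5 := mul_le_one₀ h1.2 h2.1 h2.2
  rw [occCov, abs_le]
  constructor <;> linarith [h3.1, h3.2]

lemma IsModel.abs_occCov_le_rho (h : IsModel l P Q φ) {ε r : ℝ} {f g : Set Plane → ℝ}
    (hf : ∀ O, f O ∈ Set.Icc (0 : ℝ) 1) (hg : ∀ O, g O ∈ Set.Icc (0 : ℝ) 1)
    (hfm : Measurable[windowSigma (square 0 r)] f)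
    (hgm : Measurable[windowSigma (square !₂[(2 + ε) * r, 0] r)] g) :
    |occCov P Q φ f g| ≤ rho ε P Q φ r := by
  -- The bound 1 matters: a real `sSup` dominates the members only of a set that is bounded above.
  refine le_csSup ⟨1, ?_⟩ ⟨f, g, hf, hg, hfm, hgm, rfl⟩
  rintro _ ⟨f, g, hf, hg, -, -, rfl⟩
  exact h.abs_occCov_le hf hg

/-- Visible events in distant windows are almost independent. -/
lemma IsModel.occProb_and_le (h : IsModel l P Q φ) {ε r : ℝ} {A B : Set Plane → Prop}
    (hA : IsVisible (square 0 r) A) (hB : IsVisible (square !₂[(2 + ε) * r, 0] r) B) :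
    occProb P Q φ (fun O => A O ∧ B O) ≤
      occProb P Q φ A * occProb P Q φ B + rho ε P Q φ r := by
  obtain ⟨S, hS, hAS⟩ := hA
  obtain ⟨S', hS', hBS⟩ := hB
  have h01 : ∀ (S : Set (Set Plane)) O, S.indicator (fun _ => (1 : ℝ)) O ∈ Set.Icc (0 : ℝ) 1 := by
    intro S O
    by_cases hO : O ∈ S <;> simp [hO]
  have hcov := h.abs_occCov_le_rho (ε := ε) (h01 S) (h01 S')
    (measurable_const.indicator hS) (measurable_const.indicator hS')
  have hint : ∀ (V : Set (Set Plane)),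
      MeasurableSet {ω : PointConfig × Θ | occupied ω.1 (φ ω.2) ∈ V} →
      ∫ ω, V.indicator (fun _ => (1 : ℝ)) (occupied ω.1 (φ ω.2)) ∂(P.prod Q) =
        occProb P Q φ (· ∈ V) := fun V hV =>
    integral_indicator_one (μ := P.prod Q) hV
  have hSm := measurable_occupied (φ := φ) h.measurable _ hS
  have hSm' := measurable_occupied (φ := φ) h.measurable _ hS'
  have hmul : ∀ O, S.indicator (fun _ => (1 : ℝ)) O * S'.indicator (fun _ => (1 : ℝ)) O =
      (S ∩ S').indicator (fun _ => (1 : ℝ)) O := fun O => by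
    by_cases h1 : O ∈ S <;> by_cases h2 : O ∈ S' <;> simp [h1, h2]
  rw [occCov] at hcov
  simp_rw [hmul] at hcov
  rw [hint S hSm, hint S' hSm', hint (S ∩ S') (hSm.inter hSm'), ← h.occProb_congr hAS,
    ← h.occProb_congr hBS] at hcov
  have hand : occProb P Q φ (fun O => A O ∧ B O) = occProb P Q φ (· ∈ S ∩ S') :=
    h.occProb_congr fun s r hsr => and_congr (hAS s r hsr) (hBS s r hsr)
  rw [hand]
  linarith [le_abs_self (occProb P Q φ (· ∈ S ∩ S') - occProb P Q φ A * occProb P Q φ B)]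

end Probabilities

/-! ### Crossing probabilities depend only on the side lengths. -/

section BoxCrossings

lemma convex_box (a b c d : ℝ) : Convex ℝ (box a b c d) := by
  have h0 := (convex_Icc a b).linear_preimage (EuclideanSpace.proj (𝕜 := ℝ) (0 : Fin 2) :
    Plane →L[ℝ] ℝ).toLinearMap
  have h1 := (convex_Icc c d).linear_preimage (EuclideanSpace.proj (𝕜 := ℝ) (1 : Fin 2) :
    Plane →L[ℝ] ℝ).toLinearMap
  exact h0.inter h1

lemma isClosed_box (a b c d : ℝ) : IsClosed (box a b c d) :=
  (isClosed_Icc.preimage (by fun_prop : Continuous fun x : Plane => x 0)).inter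
    (isClosed_Icc.preimage (by fun_prop : Continuous fun x : Plane => x 1))

lemma isCompact_box (a b c d : ℝ) : IsCompact (box a b c d) := by
  refine Metric.isCompact_of_isClosed_isBounded (isClosed_box a b c d) ?_
  refine (Metric.isBounded_iff_subset_closedBall 0).mpr
    ⟨(max |a| |b|) + (max |c| |d|), fun x hx => ?_⟩
  rw [mem_closedBall_zero_iff, EuclideanSpace.norm_eq, Fin.sum_univ_two]
  have h0 := abs_le_max_abs_abs hx.1.1 hx.1.2
  have h1 := abs_le_max_abs_abs hx.2.1 hx.2.2
  rw [Real.norm_eq_abs, Real.norm_eq_abs]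
  refine (Real.sqrt_le_left (by positivity)).mpr ?_
  nlinarith [abs_nonneg (x 0), abs_nonneg (x 1)]

lemma isQuad_box_horizontal {a b c d : ℝ} (hab : a < b) (hcd : c ≤ d) :
    IsQuad (box a b c d) {x ∈ box a b c d | x 0 = a} {x ∈ box a b c d | x 0 = b} where
  compact := isCompact_box a b c d
  convex := convex_box a b c d
  closed_left := (isClosed_box a b c d).inter
    (isClosed_eq (by fun_prop) continuous_const)
  closed_right := (isClosed_box a b c d).inter
    (isClosed_eq (by fun_prop) continuous_const)
  left_subset := Set.sep_subset _ _
  right_subset := Set.sep_subset _ _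
  left_nonempty := ⟨!₂[a, c], ⟨⟨le_rfl, hab.le⟩, ⟨le_rfl, hcd⟩⟩, rfl⟩
  right_nonempty := ⟨!₂[b, c], ⟨⟨hab.le, le_rfl⟩, ⟨le_rfl, hcd⟩⟩, rfl⟩
  disjoint := Set.disjoint_left.mpr fun _ hx hx' => hab.ne (hx.2.symm.trans hx'.2)

lemma isQuad_box_vertical {a b c d : ℝ} (hab : a ≤ b) (hcd : c < d) :
    IsQuad (box a b c d) {x ∈ box a b c d | x 1 = c} {x ∈ box a b c d | x 1 = d} where
  compact := isCompact_box a b c d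
  convex := convex_box a b c d
  closed_left := (isClosed_box a b c d).inter
    (isClosed_eq (by fun_prop) continuous_const)
  closed_right := (isClosed_box a b c d).inter
    (isClosed_eq (by fun_prop) continuous_const)
  left_subset := Set.sep_subset _ _
  right_subset := Set.sep_subset _ _
  left_nonempty := ⟨!₂[a, c], ⟨⟨le_rfl, hab⟩, ⟨le_rfl, hcd.le⟩⟩, rfl⟩
  right_nonempty := ⟨!₂[a, d], ⟨⟨le_rfl, hab⟩, ⟨hcd.le, le_rfl⟩⟩, rfl⟩
  disjoint := Set.disjoint_left.mpr fun _ hx hx' => hcd.ne (hx.2.symm.trans hx'.2)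

lemma hCross_iff_conn (O : Set Plane) (a b c d : ℝ) : HCross O a b c d ↔
    Conn O (box a b c d) {x ∈ box a b c d | x 0 = a} {x ∈ box a b c d | x 0 = b} := by
  constructor
  · rintro ⟨x, y, hx, hy, h⟩
    exact ⟨x, ⟨h.source_mem.2, hx⟩, y, ⟨h.target_mem.2, hy⟩, h⟩
  · rintro ⟨x, hx, y, hy, h⟩
    exact ⟨x, y, hx.2, hy.2, h⟩

lemma vCross_iff_conn (O : Set Plane) (a b c d : ℝ) : VCross O a b c d ↔
    Conn O (box a b c d) {x ∈ box a b c d | x 1 = c} {x ∈ box a b c d | x 1 = d} := by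
  constructor
  · rintro ⟨x, y, hx, hy, h⟩
    exact ⟨x, ⟨h.source_mem.2, hx⟩, y, ⟨h.target_mem.2, hy⟩, h⟩
  · rintro ⟨x, hx, y, hy, h⟩
    exact ⟨x, y, hx.2, hy.2, h⟩

lemma isVisible_hCross {K : Set Plane} {a b c d δ : ℝ} (hab : a < b) (hcd : c ≤ d) (hδ : 0 < δ)
    (hK : Metric.thickening δ (box a b c d) ⊆ K) : IsVisible K fun O => HCross O a b c d := by
  simp_rw [hCross_iff_conn]
  exact (isQuad_box_horizontal hab hcd).isVisible hδ hK

lemma isVisible_vCross {K : Set Plane} {a b c d δ : ℝ} (hab : a ≤ b) (hcd : c < d) (hδ : 0 < δ)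
    (hK : Metric.thickening δ (box a b c d) ⊆ K) : IsVisible K fun O => VCross O a b c d := by
  simp_rw [vCross_iff_conn]
  exact (isQuad_box_vertical hab hcd).isVisible hδ hK

lemma joinedIn_preimage_iff (T : Plane ≃ᵢ Plane) (S : Set Plane) (x y : Plane) :
    JoinedIn (T ⁻¹' S) x y ↔ JoinedIn S (T x) (T y) := by
  constructor
  · intro h
    have := h.map T.continuous
    rwa [Set.image_preimage_eq _ T.surjective] at this
  · intro h
    have := h.map T.symm.continuous
    rw [T.symm_apply_apply, T.symm_apply_apply] at this
    refine this.mono ?_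
    rintro _ ⟨z, hz, rfl⟩
    rwa [Set.mem_preimage, T.apply_symm_apply]

lemma hCross_translate (O : Set Plane) (v : Plane) (a b c d : ℝ) :
    HCross (IsometryEquiv.addRight v ⁻¹' O) a b c d ↔
      HCross O (a + v 0) (b + v 0) (c + v 1) (d + v 1) := by
  set T := IsometryEquiv.addRight v
  have hT : ∀ x i, T x i = x i + v i := fun x i => rfl
  have hbox : box a b c d = T ⁻¹' box (a + v 0) (b + v 0) (c + v 1) (d + v 1) := by
    ext x
    simp [box, hT]
  rw [HCross, HCross]
  symm
  rw [T.surjective.exists]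
  refine exists_congr fun x => ?_
  rw [T.surjective.exists]
  refine exists_congr fun y => ?_
  rw [hbox, ← Set.preimage_inter, joinedIn_preimage_iff, hT, hT, add_left_inj, add_left_inj]

/-- The rotation by a right angle as an isometry. -/
def rotIso : Plane ≃ᵢ Plane where
  toFun := rot
  invFun y := !₂[y 1, -(y 0)]
  left_inv x := by ext i; fin_cases i <;> simp [rot]
  right_inv x := by ext i; fin_cases i <;> simp [rot]
  isometry_toFun := Isometry.of_dist_eq fun x y => by
    rw [EuclideanSpace.dist_eq, EuclideanSpace.dist_eq, Fin.sum_univ_two, Fin.sum_univ_two]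
    simp only [rot, Real.dist_eq, sq_abs]
    congr 1
    simp only [Matrix.cons_val_zero, Matrix.cons_val_one]
    ring

lemma hCross_rotate (O : Set Plane) (a b c d : ℝ) :
    HCross (rotIso ⁻¹' O) a b c d ↔ VCross O (-d) (-c) a b := by
  have h0 : ∀ x, rotIso x 0 = -(x 1) := fun x => rfl
  have h1 : ∀ x, rotIso x 1 = x 0 := fun x => rfl
  have hbox : box a b c d = rotIso ⁻¹' box (-d) (-c) a b := by
    ext x
    simp only [box, Set.mem_ofPred_eq, Set.mem_preimage, h0, h1, Set.mem_Icc, neg_le_neg_iff]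
    tauto
  rw [HCross, VCross]
  symm
  rw [rotIso.surjective.exists]
  refine exists_congr fun x => ?_
  rw [rotIso.surjective.exists]
  refine exists_congr fun y => ?_
  rw [hbox, ← Set.preimage_inter, joinedIn_preimage_iff, h1, h1]

variable {Θ : Type*} [MeasurableSpace Θ] {l : ℝ≥0} {P : Measure PointConfig} {Q : Measure Θ}
  {φ : Θ → Plane → ℝ≥0}

/-- All horizontal crossing probabilities of rectangles with the same side lengths agree, with the
analogous statement for the complements. -/
lemma IsModel.occProb_hCross (h : IsModel l P Q φ) {a b c d : ℝ} (hab : a < b) (hcd : c ≤ d) :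
    occProb P Q φ (fun O => HCross O a b c d) =
      occProb P Q φ (fun O => HCross O 0 (b - a) 0 (d - c)) := by
  have hv := isVisible_hCross (K := Set.univ) (sub_pos.mpr hab) (sub_nonneg.mpr hcd) one_pos
    (Set.subset_univ (Metric.thickening 1 (box 0 (b - a) 0 (d - c))))
  rw [h.occProb_preimage (T := IsometryEquiv.addRight !₂[a, c]) (h.stationary _) hv]
  simp_rw [hCross_translate]
  simp

/-- A quarter turn makes the crossing horizontal, and a translation brings the rectangle to the
origin. -/
lemma IsModel.occProb_vCross (h : IsModel l P Q φ) {a b c d : ℝ} (hab : a ≤ b) (hcd : c < d) :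
    occProb P Q φ (fun O => VCross O a b c d) =
      occProb P Q φ (fun O => HCross O 0 (d - c) 0 (b - a)) := by
  have hv := isVisible_hCross (K := Set.univ) hcd (neg_le_neg hab) one_pos
    (Set.subset_univ (Metric.thickening 1 (box c d (-b) (-a))))
  have h1 := h.occProb_preimage (T := rotIso) h.rotInvariant hv
  simp_rw [hCross_rotate, neg_neg] at h1
  rw [← h1, h.occProb_hCross hcd (neg_le_neg hab)]
  congr! 3
  ring

lemma IsModel.occProb_not_hCross (h : IsModel l P Q φ) {a b c d : ℝ} (hab : a < b) (hcd : c ≤ d) :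
    occProb P Q φ (fun O => ¬ HCross O a b c d) =
      1 - occProb P Q φ (fun O => HCross O 0 (b - a) 0 (d - c)) := by
  rw [h.occProb_not (isVisible_hCross (K := Set.univ) hab hcd one_pos (Set.subset_univ _)),
    h.occProb_hCross hab hcd]

lemma IsModel.occProb_not_vCross (h : IsModel l P Q φ) {a b c d : ℝ} (hab : a ≤ b) (hcd : c < d) :
    occProb P Q φ (fun O => ¬ VCross O a b c d) =
      1 - occProb P Q φ (fun O => HCross O 0 (d - c) 0 (b - a)) := by
  rw [h.occProb_not (isVisible_vCross (K := Set.univ) hab hcd one_pos (Set.subset_univ _)),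
    h.occProb_vCross hab hcd]

end BoxCrossings

/-! ### The deterministic recursion. -/

section Recursion

/-- A function that is small once, improves when its argument is tripled and varies little in
between, tends to zero. -/
lemma tendsto_zero_of_tripling {x e : ℝ → ℝ} {n₀ : ℝ} (hn₀ : 0 < n₀) (hx0 : ∀ n, 0 ≤ x n)
    (he : Tendsto e atTop (𝓝 0)) (he' : ∀ n, n₀ ≤ n → e n ≤ 1 / 1000)
    (hrec : ∀ n, n₀ ≤ n → x (3 * n) ≤ 49 * x n ^ 2 + e n)
    (hinter : ∀ n m, n₀ ≤ n → n ≤ m → m ≤ 3 * n → x m ≤ 7 * x n) (hsmall : x n₀ < 1 / 200) :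
    Tendsto x atTop (𝓝 0) := by
  have hle : ∀ k : ℕ, n₀ ≤ 3 ^ k * n₀ := fun k =>
    le_mul_of_one_le_left hn₀.le (one_le_pow₀ (by norm_num))
  have hstep : ∀ k : ℕ, x (3 ^ (k + 1) * n₀) ≤ 49 * x (3 ^ k * n₀) ^ 2 + e (3 ^ k * n₀) := by
    intro k
    have := hrec _ (hle k)
    rwa [← mul_assoc, ← pow_succ'] at this
  -- The bound reproduces itself: 49/200² + 1/1000 < 1/200. In `hquarter` it is used as 49/200 <
  -- 1/4.
  have hsm : ∀ k : ℕ, x (3 ^ k * n₀) < 1 / 200 := by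
    intro k
    induction k with
    | zero => simpa using hsmall
    | succ k ih =>
      have h1 := hstep k
      have h2 := he' _ (hle k)
      have h3 := hx0 (3 ^ k * n₀)
      nlinarith
  have hquarter : ∀ k : ℕ, x (3 ^ (k + 1) * n₀) ≤ x (3 ^ k * n₀) / 4 + e (3 ^ k * n₀) := by
    intro k
    have h1 := hstep k
    have h2 := hsm k
    have h3 := hx0 (3 ^ k * n₀)
    nlinarith
  have hpow : Tendsto (fun k : ℕ => (3 : ℝ) ^ k * n₀) atTop atTop :=
    (tendsto_pow_atTop_atTop_of_one_lt (by norm_num)).atTop_mul_const hn₀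
  rw [Metric.tendsto_atTop]
  intro δ hδ
  -- Along the powers of 3 the values eventually stay below 3η, and a factor 7 is lost in between;
  -- 21η < 28η = δ.
  set η := δ / 28 with hη
  have hηpos : 0 < η := by positivity
  obtain ⟨K, hK⟩ := Filter.eventually_atTop.mp
    ((he.comp hpow).eventually (gt_mem_nhds (show (0 : ℝ) < η from hηpos)))
  have hgeo : ∀ j : ℕ, x (3 ^ (K + j) * n₀) ≤ (1 / 4) ^ j + 2 * η := by
    intro j
    induction j with
    | zero =>
      have := hsm K
      simp only [add_zero, pow_zero]
      linarith
    | succ j ih =>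
      have h1 := hquarter (K + j)
      have h2 : e (3 ^ (K + j) * n₀) < η := hK (K + j) (Nat.le_add_right _ _)
      rw [← add_assoc, pow_succ (1 / 4 : ℝ)]
      linarith
  obtain ⟨J, hJ⟩ := exists_pow_lt_of_lt_one hηpos (by norm_num : (1 / 4 : ℝ) < 1)
  refine ⟨3 ^ (K + J) * n₀, fun m hm => ?_⟩
  rw [Real.dist_eq, sub_zero, abs_of_nonneg (hx0 m)]
  have hm1 : 1 ≤ m / n₀ := by
    rw [le_div_iff₀ hn₀, one_mul]
    exact (hle _).trans hm
  obtain ⟨k, hk1, hk2⟩ := exists_nat_pow_near hm1 (by norm_num : (1 : ℝ) < 3)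
  rw [le_div_iff₀ hn₀] at hk1
  rw [div_lt_iff₀ hn₀] at hk2
  have hlt : (3 : ℝ) ^ (K + J) < 3 ^ (k + 1) := lt_of_mul_lt_mul_right (hm.trans_lt hk2) hn₀.le
  have hKJ : K + J ≤ k := Nat.lt_succ_iff.mp ((pow_lt_pow_iff_right₀ (by norm_num)).mp hlt)
  obtain ⟨i, rfl⟩ := Nat.exists_eq_add_of_le (hKJ.trans' (Nat.le_add_right K J))
  have h1 := hinter _ m (hle (K + i)) hk1 (by rw [← mul_assoc, ← pow_succ']; exact hk2.le)
  have h2 := hgeo i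
  have h3 : (1 / 4 : ℝ) ^ i ≤ (1 / 4) ^ J :=
    pow_le_pow_of_le_one (by norm_num) (by norm_num) (by omega)
  have h4 : δ = 28 * η := by rw [hη]; ring
  linarith

end Recursion

/-! ### Renormalization from scale n to scale 3n. -/

section Renormalization

variable {Θ : Type*} [MeasurableSpace Θ] {l : ℝ≥0} {P : Measure PointConfig} {Q : Measure Θ}
  {φ : Θ → Plane → ℝ≥0}

lemma IsModel.occProb_or_seven_le (h : IsModel l P Q φ) {A : Set Plane → Prop} {x : ℝ}
    {B : Fin 7 → Set Plane → Prop} (hA : ∀ O, A O → ∃ i, B i O)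
    (hB : ∀ i, occProb P Q φ (B i) ≤ x) : occProb P Q φ A ≤ 7 * x := by
  have := h.isProbabilityMeasure_prod
  calc occProb P Q φ A ≤ (P.prod Q).real (⋃ i, {ω | B i (occupied ω.1 (φ ω.2))}) :=
        measureReal_mono fun ω hω => Set.mem_iUnion.mpr (hA _ hω)
    _ ≤ ∑ i, occProb P Q φ (B i) := measureReal_iUnion_fintype_le _
    _ ≤ ∑ _i : Fin 7, x := Finset.sum_le_sum fun i _ => hB i
    _ = 7 * x := by simp

/-- The long crossing of a strip is built from seven shorter crossings. -/
lemma hCross_of_seven {O : Set Plane} {n : ℝ} (hn : 0 < n)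
    (h1 : HCross O 0 (3 * n) 0 n) (h2 : HCross O (2 * n) (5 * n) 0 n)
    (h3 : HCross O (4 * n) (7 * n) 0 n) (h4 : HCross O (6 * n) (9 * n) 0 n)
    (v1 : VCross O (2 * n) (3 * n) 0 n) (v2 : VCross O (4 * n) (5 * n) 0 n)
    (v3 : VCross O (6 * n) (7 * n) 0 n) : HCross O 0 (9 * n) 0 n := by
  have g1 := h1.glue h2 v1 (by linarith) (by linarith) (by linarith)
  have g2 := g1.glue h3 v2 (by linarith) (by linarith) (by linarith)
  exact g2.glue h4 v3 (by linarith) (by linarith) (by linarith)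

/-- A crossing of a narrow strip contains one of seven crossings of smaller rectangles. -/
lemma HCross.seven {O : Set Plane} {n : ℝ} (hn : 0 < n) (h : HCross O 0 n 0 (9 * n)) :
    HCross O 0 n 0 (3 * n) ∨ HCross O 0 n (2 * n) (5 * n) ∨ HCross O 0 n (4 * n) (7 * n) ∨
      HCross O 0 n (6 * n) (9 * n) ∨ VCross O 0 n (2 * n) (3 * n) ∨ VCross O 0 n (4 * n) (5 * n) ∨
      VCross O 0 n (6 * n) (7 * n) := by
  rcases h.split (c' := 2 * n) (d' := 3 * n) (by linarith) with h | h | h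
  · tauto
  · tauto
  rcases h.split (c' := 4 * n) (d' := 5 * n) (by linarith) with h | h | h
  · tauto
  · tauto
  rcases h.split (c' := 6 * n) (d' := 7 * n) (by linarith) with h | h | h <;> tauto

/-- Each of the seven crossings that are glued fails with probability at most that of the 3n × n
one: four are translates of it, and the three square crossings are, up to symmetry, implied by it.
-/
lemma IsModel.occProb_not_long_le (h : IsModel l P Q φ) {n : ℝ} (hn : 0 < n) :
    occProb P Q φ (fun O => ¬ HCross O 0 (9 * n) 0 n) ≤
      7 * occProb P Q φ (fun O => ¬ HCross O 0 (3 * n) 0 n) := by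
  have hH : ∀ a b : ℝ, b - a = 3 * n → occProb P Q φ (fun O => ¬ HCross O a b 0 n) ≤
      occProb P Q φ (fun O => ¬ HCross O 0 (3 * n) 0 n) := by
    intro a b hab
    rw [h.occProb_not_hCross (by linarith) hn.le,
      h.occProb_not_hCross (a := 0) (b := 3 * n) (by linarith) hn.le, hab, sub_zero, sub_zero]
  have hV : ∀ a b : ℝ, b - a = n → occProb P Q φ (fun O => ¬ VCross O a b 0 n) ≤
      occProb P Q φ (fun O => ¬ HCross O 0 (3 * n) 0 n) := by
    intro a b hab
    rw [h.occProb_not_vCross (by linarith) hn,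
      h.occProb_not_hCross (a := 0) (b := 3 * n) (by linarith) hn.le, hab, sub_zero, sub_zero]
    have := h.occProb_mono (A := fun O => HCross O 0 (3 * n) 0 n) (B := fun O => HCross O 0 n 0 n)
      fun O hO => hO.mono le_rfl hn.le (by linarith) le_rfl le_rfl
    linarith
  refine h.occProb_or_seven_le (B := ![fun O => ¬ HCross O 0 (3 * n) 0 n,
    fun O => ¬ HCross O (2 * n) (5 * n) 0 n, fun O => ¬ HCross O (4 * n) (7 * n) 0 n,
    fun O => ¬ HCross O (6 * n) (9 * n) 0 n, fun O => ¬ VCross O (2 * n) (3 * n) 0 n,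
    fun O => ¬ VCross O (4 * n) (5 * n) 0 n, fun O => ¬ VCross O (6 * n) (7 * n) 0 n])
    (fun O hO => ?_) fun i => ?_
  · by_contra! hc
    simp only [Fin.forall_fin_succ, Matrix.cons_val_zero, Matrix.cons_val_succ, not_not,
      IsEmpty.forall_iff, and_true] at hc
    obtain ⟨h1, h2, h3, h4, v1, v2, v3⟩ := hc
    exact hO (hCross_of_seven hn h1 h2 h3 h4 v1 v2 v3)
  · fin_cases i
    exacts [hH _ _ (by ring), hH _ _ (by ring), hH _ _ (by ring), hH _ _ (by ring),
      hV _ _ (by ring), hV _ _ (by ring), hV _ _ (by ring)]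

/-- The curve either stays within one of four overlapping windows of height 3n or crosses one of the
three square overlaps vertically. A square is harder to cross than the n × 3n rectangle containing
it. -/
lemma IsModel.occProb_high_le (h : IsModel l P Q φ) {n : ℝ} (hn : 0 < n) :
    occProb P Q φ (fun O => HCross O 0 n 0 (9 * n)) ≤
      7 * occProb P Q φ (fun O => HCross O 0 n 0 (3 * n)) := by
  have hH : ∀ c d : ℝ, d - c = 3 * n → occProb P Q φ (fun O => HCross O 0 n c d) ≤
      occProb P Q φ (fun O => HCross O 0 n 0 (3 * n)) := by
    intro c d hcd
    rw [h.occProb_hCross hn (by linarith), hcd, sub_zero]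
  have hV : ∀ c d : ℝ, d - c = n → occProb P Q φ (fun O => VCross O 0 n c d) ≤
      occProb P Q φ (fun O => HCross O 0 n 0 (3 * n)) := by
    intro c d hcd
    rw [h.occProb_vCross hn.le (by linarith), hcd, sub_zero]
    exact h.occProb_mono fun O hO => hO.mono le_rfl hn.le le_rfl le_rfl (by linarith)
  refine h.occProb_or_seven_le (B := ![fun O => HCross O 0 n 0 (3 * n),
    fun O => HCross O 0 n (2 * n) (5 * n), fun O => HCross O 0 n (4 * n) (7 * n),
    fun O => HCross O 0 n (6 * n) (9 * n), fun O => VCross O 0 n (2 * n) (3 * n),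
    fun O => VCross O 0 n (4 * n) (5 * n), fun O => VCross O 0 n (6 * n) (7 * n)])
    (fun O hO => ?_) fun i => ?_
  · rcases hO.seven hn with h | h | h | h | h | h | h
    exacts [⟨0, h⟩, ⟨1, h⟩, ⟨2, h⟩, ⟨3, h⟩, ⟨4, h⟩, ⟨5, h⟩, ⟨6, h⟩]
  · fin_cases i
    exacts [hH _ _ (by ring), hH _ _ (by ring), hH _ _ (by ring), hH _ _ (by ring),
      hV _ _ (by ring), hV _ _ (by ring), hV _ _ (by ring)]

lemma thickening_box_subset_square {a b c d δ r : ℝ} {z : Plane} (ha : z 0 - r ≤ a - δ)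
    (hb : b + δ ≤ z 0 + r) (hc : z 1 - r ≤ c - δ) (hd : d + δ ≤ z 1 + r) :
    Metric.thickening δ (box a b c d) ⊆ square z r := by
  intro x hx
  obtain ⟨y, hy, hxy⟩ := Metric.mem_thickening_iff.mp hx
  have hcoord : ∀ i, |x i - y i| < δ := fun i => by
    have h1 := PiLp.norm_apply_le (x - y) i
    rw [← dist_eq_norm] at h1
    exact lt_of_le_of_lt h1 hxy
  have h0 := abs_lt.mp (hcoord 0)
  have h1 := abs_lt.mp (hcoord 1)
  obtain ⟨⟨hy1, hy2⟩, hy3, hy4⟩ := hy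
  intro i
  fin_cases i
  · exact abs_le.mpr ⟨by simp only [Fin.zero_eta]; linarith, by simp only [Fin.zero_eta]; linarith⟩
  · exact abs_le.mpr ⟨by simp only [Fin.mk_one]; linarith, by simp only [Fin.mk_one]; linarith⟩

/-- The radius of the two windows containing the columns of width `n` and height `9n`. -/
noncomputable def windowRadius (n : ℝ) : ℕ := ⌈9 / 2 * n⌉₊ + 1

lemma windowRadius_bounds {n : ℝ} (hn : 0 ≤ n) :
    9 / 2 * n + 1 ≤ windowRadius n ∧ (windowRadius n : ℝ) < 9 / 2 * n + 2 := by
  have h1 := Nat.le_ceil (9 / 2 * n)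
  have h2 := Nat.ceil_lt_add_one (show 0 ≤ 9 / 2 * n by positivity)
  rw [windowRadius]
  push_cast
  constructor <;> linarith

variable {ε : ℝ}

/-- The two columns of width `n` lie in the two windows and in a common column of width `3n`. -/
lemma column_geometry (hε : 0 < ε) (hε' : ε ≤ 1 / 5) {n r : ℝ} (hn : 24 ≤ n)
    (hr : 9 / 2 * n + 1 ≤ r) (hr' : r < 9 / 2 * n + 2) :
    Metric.thickening (1 / 2) (box (r - 1 - n) (r - 1) (-(9 / 2 * n)) (9 / 2 * n)) ⊆ square 0 r ∧
    Metric.thickening (1 / 2)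
        (box ((1 + ε) * r + 1) ((1 + ε) * r + 1 + n) (-(9 / 2 * n)) (9 / 2 * n)) ⊆
      square !₂[(2 + ε) * r, 0] r ∧
    (1 + ε) * r + 1 + n ≤ r - 1 - n + 3 * n ∧ r - 1 ≤ (1 + ε) * r + 1 := by
  -- The columns sit at the facing sides of the windows, a gap of ε r + 2 apart. This gap is at most
  -- n because ε r < 9n/10 + 2/5 and 24 ≤ n, so both columns fit into width 3n.
  have h1 : ε * r ≤ 1 / 5 * r := mul_le_mul_of_nonneg_right hε' (by linarith)
  have h2 : 0 ≤ ε * r := mul_nonneg hε.le (by linarith)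
  have e0 : ∀ i, (0 : Plane) i = 0 := fun _ => rfl
  have e1 : (!₂[(2 + ε) * r, 0] : Plane) 0 = (2 + ε) * r := rfl
  have e2 : (!₂[(2 + ε) * r, 0] : Plane) 1 = 0 := rfl
  refine ⟨thickening_box_subset_square ?_ ?_ ?_ ?_, thickening_box_subset_square ?_ ?_ ?_ ?_,
    ?_, ?_⟩ <;> (try rw [e0]) <;> (try rw [e1]) <;> (try rw [e2]) <;> linarith

/-- Turned upright, the large rectangle is a column of width 3n and height 9n. Without a vertical
crossing of it there is none in either of its two separated subcolumns of width n; each of these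
fails with probability at most 7x, whence 49. -/
lemma IsModel.renormalize_not (h : IsModel l P Q φ) (hε : 0 < ε) (hε' : ε ≤ 1 / 5) {n : ℝ}
    (hn : 24 ≤ n) :
    occProb P Q φ (fun O => ¬ HCross O 0 (3 * (3 * n)) 0 (3 * n)) ≤
      49 * occProb P Q φ (fun O => ¬ HCross O 0 (3 * n) 0 n) ^ 2 +
        rho ε P Q φ (windowRadius n : ℝ) := by
  have hn0 : 0 < n := by linarith
  obtain ⟨hr, hr'⟩ := windowRadius_bounds hn0.le
  set r : ℝ := ((windowRadius n : ℕ) : ℝ)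
  obtain ⟨hw1, hw2, hwidth, hsep⟩ := column_geometry hε hε' hn hr hr'
  set x := occProb P Q φ (fun O => ¬ HCross O 0 (3 * n) 0 n) with hx
  have hx0 : 0 ≤ x := occProb_nonneg _
  have hlong : ∀ a : ℝ, occProb P Q φ
      (fun O => ¬ VCross O a (a + n) (-(9 / 2 * n)) (9 / 2 * n)) ≤ 7 * x := by
    intro a
    refine le_trans (le_of_eq ?_) (h.occProb_not_long_le hn0)
    rw [h.occProb_not_vCross (by linarith) (by linarith),
      h.occProb_not_hCross (by linarith) hn0.le]
    congr! 4 <;> ring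
  have h1 : occProb P Q φ (fun O => ¬ HCross O 0 (3 * (3 * n)) 0 (3 * n)) =
      occProb P Q φ (fun O => ¬ VCross O (r - 1 - n) (r - 1 - n + 3 * n)
        (-(9 / 2 * n)) (9 / 2 * n)) := by
    rw [h.occProb_not_vCross (by linarith) (by linarith),
      h.occProb_not_hCross (by linarith) (by linarith)]
    congr! 4 <;> ring
  have h2 : occProb P Q φ (fun O => ¬ VCross O (r - 1 - n) (r - 1) (-(9 / 2 * n)) (9 / 2 * n)) ≤
      7 * x := by
    have := hlong (r - 1 - n)
    rwa [sub_add_cancel] at this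
  have h3 := hlong ((1 + ε) * r + 1)
  rw [h1]
  calc _ ≤ occProb P Q φ (fun O => ¬ VCross O (r - 1 - n) (r - 1) (-(9 / 2 * n)) (9 / 2 * n) ∧
        ¬ VCross O ((1 + ε) * r + 1) ((1 + ε) * r + 1 + n) (-(9 / 2 * n)) (9 / 2 * n)) := by
        refine h.occProb_mono fun O hO => ⟨fun hv => hO (hv.mono ?_ ?_ ?_ ?_ ?_),
          fun hv => hO (hv.mono ?_ ?_ ?_ ?_ ?_)⟩ <;> linarith
    _ ≤ _ := h.occProb_and_le (isVisible_vCross (by linarith) (by linarith) (by norm_num) hw1).not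
        (isVisible_vCross (by linarith) (by linarith) (by norm_num) hw2).not
    _ ≤ (7 * x) * (7 * x) + rho ε P Q φ r := by
        have := mul_le_mul h2 h3 (occProb_nonneg _) (by linarith)
        linarith
    _ = 49 * x ^ 2 + rho ε P Q φ r := by ring

/-- A horizontal crossing of the wide column crosses both separated subcolumns of width n, each with
probability at most 7x. -/
lemma IsModel.renormalize (h : IsModel l P Q φ) (hε : 0 < ε) (hε' : ε ≤ 1 / 5) {n : ℝ}
    (hn : 24 ≤ n) :
    occProb P Q φ (fun O => HCross O 0 (3 * n) 0 (3 * (3 * n))) ≤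
      49 * occProb P Q φ (fun O => HCross O 0 n 0 (3 * n)) ^ 2 +
        rho ε P Q φ (windowRadius n : ℝ) := by
  have hn0 : 0 < n := by linarith
  obtain ⟨hr, hr'⟩ := windowRadius_bounds hn0.le
  set r : ℝ := ((windowRadius n : ℕ) : ℝ)
  obtain ⟨hw1, hw2, hwidth, hsep⟩ := column_geometry hε hε' hn hr hr'
  set x := occProb P Q φ (fun O => HCross O 0 n 0 (3 * n)) with hx
  have hx0 : 0 ≤ x := occProb_nonneg _
  have hhigh : ∀ a : ℝ, occProb P Q φ
      (fun O => HCross O a (a + n) (-(9 / 2 * n)) (9 / 2 * n)) ≤ 7 * x := by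
    intro a
    refine le_trans (le_of_eq ?_) (h.occProb_high_le hn0)
    rw [h.occProb_hCross (by linarith) (by linarith)]
    congr! 3 <;> ring
  have h1 : occProb P Q φ (fun O => HCross O 0 (3 * n) 0 (3 * (3 * n))) =
      occProb P Q φ (fun O => HCross O (r - 1 - n) (r - 1 - n + 3 * n)
        (-(9 / 2 * n)) (9 / 2 * n)) := by
    rw [h.occProb_hCross (a := r - 1 - n) (by linarith) (by linarith)]
    congr! 3 <;> ring
  have h2 : occProb P Q φ (fun O => HCross O (r - 1 - n) (r - 1) (-(9 / 2 * n)) (9 / 2 * n)) ≤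
      7 * x := by
    have := hhigh (r - 1 - n)
    rwa [sub_add_cancel] at this
  have h3 := hhigh ((1 + ε) * r + 1)
  rw [h1]
  calc _ ≤ occProb P Q φ (fun O => HCross O (r - 1 - n) (r - 1) (-(9 / 2 * n)) (9 / 2 * n) ∧
        HCross O ((1 + ε) * r + 1) ((1 + ε) * r + 1 + n) (-(9 / 2 * n)) (9 / 2 * n)) := by
        refine h.occProb_mono fun O hO => ⟨hO.mono ?_ ?_ ?_ ?_ ?_, hO.mono ?_ ?_ ?_ ?_ ?_⟩ <;>
          linarith
    _ ≤ _ := h.occProb_and_le (isVisible_hCross (by linarith) (by linarith) (by norm_num) hw1)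
        (isVisible_hCross (by linarith) (by linarith) (by norm_num) hw2)
    _ ≤ (7 * x) * (7 * x) + rho ε P Q φ r := by
        have := mul_le_mul h2 h3 (occProb_nonneg _) (by linarith)
        linarith
    _ = 49 * x ^ 2 + rho ε P Q φ r := by ring

lemma tendsto_windowRadius : Tendsto windowRadius atTop atTop :=
  (tendsto_add_atTop_nat 1).comp (tendsto_nat_ceil_atTop.comp
    (tendsto_id.const_mul_atTop (show (0 : ℝ) < 9 / 2 by norm_num)))

end Renormalization

end GilbertDisc

theorem proposition4p1 {Θ : Type*} [MeasurableSpace Θ]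
    (P : ℝ≥0 → Measure GilbertDisc.PointConfig)
    (hP : ∀ l, GilbertDisc.IsPoissonLaw l (P l))
    (Q : Measure Θ) [IsProbabilityMeasure Q]
    (φ : Θ → GilbertDisc.Plane → ℝ≥0)
    (hφ : Measurable (Function.uncurry φ))
    (hstat : GilbertDisc.IsStationaryField Q φ)
    (hrot : GilbertDisc.IsRotationInvariantField Q φ)
    (ε : ℝ) (hε : 0 < ε) (hε' : ε ≤ 1 / 5)
    (I : Set ℝ≥0) (hI : I.OrdConnected)
    (hρ : TendstoUniformlyOn
      (fun (n : ℕ) (l : ℝ≥0) => GilbertDisc.rho ε (P l) Q φ (n : ℝ)) (fun _ => 0) atTop I) :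
    ∃ N : ℕ, 1 ≤ N ∧ ∀ l ∈ I,
      ((∃ n : ℝ, (N : ℝ) ≤ n ∧ 1 - 1 / 200 < GilbertDisc.crossProb (P l) Q φ (3 * n) n) →
        Tendsto (fun n : ℝ => GilbertDisc.crossProb (P l) Q φ (3 * n) n) atTop (𝓝 1)) ∧
      ((∃ n : ℝ, (N : ℝ) ≤ n ∧ GilbertDisc.crossProb (P l) Q φ n (3 * n) < 1 / 200) →
        Tendsto (fun n : ℝ => GilbertDisc.crossProb (P l) Q φ n (3 * n)) atTop (𝓝 0)) := by
  open GilbertDisc in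
  obtain ⟨N₀, hN₀⟩ := Filter.eventually_atTop.mp
    (Metric.tendstoUniformlyOn_iff.mp hρ (1 / 1000) (by norm_num))
  -- 24 is the scale required by `column_geometry`; beyond `N₀` the correlation stays below the
  -- 1/1000 allowed in the recursion, because `windowRadius n` exceeds `n`.
  refine ⟨max N₀ 24, le_max_of_le_right (by norm_num), fun l hl => ?_⟩
  have h : IsModel l (P l) Q φ := ⟨hP l, inferInstance, hφ, hstat, hrot⟩
  have hbounds : ∀ n₀ : ℝ, ((max N₀ 24 : ℕ) : ℝ) ≤ n₀ → 24 ≤ n₀ ∧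
      ∀ n, n₀ ≤ n → rho ε (P l) Q φ (windowRadius n : ℝ) ≤ 1 / 1000 := by
    intro n₀ hn₀
    have h1 : (24 : ℝ) ≤ (max N₀ 24 : ℕ) := by exact_mod_cast le_max_right N₀ 24
    have h2 : (N₀ : ℝ) ≤ (max N₀ 24 : ℕ) := by exact_mod_cast le_max_left N₀ 24
    refine ⟨h1.trans hn₀, fun n hn => ?_⟩
    have h3 := (windowRadius_bounds (n := n) (by linarith)).1
    have h4 : N₀ ≤ windowRadius n := by
      have : (N₀ : ℝ) ≤ windowRadius n := by linarith
      exact_mod_cast this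
    have h5 := hN₀ _ h4 l hl
    rw [dist_zero_left, Real.norm_eq_abs] at h5
    exact (le_abs_self _).trans h5.le
  have he : Tendsto (fun n : ℝ => rho ε (P l) Q φ (windowRadius n : ℝ)) atTop (𝓝 0) :=
    (hρ.tendsto_at hl).comp tendsto_windowRadius
  refine ⟨?_, ?_⟩
  · rintro ⟨n₀, hn₀, hcross⟩
    obtain ⟨h24, hsmall⟩ := hbounds n₀ hn₀
    have hcompl : ∀ n, 0 < n → crossProb (P l) Q φ (3 * n) n =
        1 - occProb (P l) Q φ (fun O => ¬ HCross O 0 (3 * n) 0 n) := by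
      intro n hn
      rw [h.occProb_not_hCross (by linarith) hn.le, sub_zero, sub_zero, sub_sub_cancel]
      rfl
    have hlim : Tendsto (fun n : ℝ => occProb (P l) Q φ (fun O => ¬ HCross O 0 (3 * n) 0 n))
        atTop (𝓝 0) := by
      refine tendsto_zero_of_tripling (n₀ := n₀) (by linarith) (fun n => occProb_nonneg _) he hsmall
        (fun n hn => h.renormalize_not hε hε' (h24.trans hn)) (fun n m hn hnm hm => ?_) ?_
      -- For n ≤ m ≤ 3n a long crossing of the 9n × n rectangle contains one of the 3m × m
      -- rectangle, since 3m ≤ 9n.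
      · refine (h.occProb_mono (B := fun O => ¬ HCross O 0 (9 * n) 0 n) fun O hO hc => hO ?_).trans
          (h.occProb_not_long_le (n := n) (by linarith))
        exact hc.mono le_rfl (by linarith) (by linarith) le_rfl hnm
      · rw [hcompl n₀ (by linarith)] at hcross
        linarith
    have h1 := hlim.const_sub 1
    rw [sub_zero] at h1
    refine h1.congr' ?_
    filter_upwards [eventually_gt_atTop 0] with n hn
    exact (hcompl n hn).symm
  · rintro ⟨n₀, hn₀, hcross⟩
    obtain ⟨h24, hsmall⟩ := hbounds n₀ hn₀
    refine tendsto_zero_of_tripling (x := fun n => occProb (P l) Q φ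
      (fun O => HCross O 0 n 0 (3 * n))) (n₀ := n₀) (by linarith) (fun n => occProb_nonneg _) he
      hsmall (fun n hn => h.renormalize hε hε' (h24.trans hn)) (fun n m hn hnm hm => ?_) hcross
    -- Dually, crossing the m × 3m rectangle entails crossing the narrower and taller n × 9n one.
    refine (h.occProb_mono (B := fun O => HCross O 0 n 0 (9 * n)) fun O hO => ?_).trans
      (h.occProb_high_le (n := n) (by linarith))
    exact hO.mono le_rfl (by linarith) hnm le_rfl (by linarith)
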